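/- Let $n\ge 1$ and consider the complex-valued channel $y=Hx+z$ with a deterministic non-singular matrix $H\in\mathbb C^{n\times n}$, where the input $x$ and the noise $z$ are independent random vectors in $\mathbb C^n$. For a random vector $v$ with mean $m$ write $C_v=E[(v-m)(v-m)^H]$ for its covariance matrix and $P_v=E[(v-m)(v-m)^T]$ for its complementary covariance matrix; let $\|\cdot\|_2$ be the Euclidean operator norm, and let $\log$ be the logarithm to an arbitrary fixed base greater than $1$. Let $z$ be Gaussian (that is, its real and imaginary parts are jointly Gaussian) and zero-mean, with non-singular $C_z$, let $B_z$ be a matrix with $C_z=B_zB_z^H$, and assume $$\|B_z^{-1}P_zB_z^{-T}\|_2<1,\qquad S\ge 2n\,\|H^{-1}C_zH^{-H}\|_2 .$$ Let $C=\sup I(x;Hx+z)$, where $I$ denotes mutual information and the supremum is over all inputs $x$ that have a probability density on $\mathbb C^n\cong\mathbb R^{2n}$ and satisfy the power constraint $E[x^Hx]\le S$; this is the capacity of the channel. Let $x'$ be the input that is used when it is wrongly believed that $P_z=0$: the zero-mean Gaussian random vector, independent of $z$, with $$C_{x'}=\tfrac1n\bigl(S+\operatorname{tr}(H^{-1}C_zH^{-H})\bigr)I_n-H^{-1}C_zH^{-H},\qquad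 P_{x'}=0 .$$ Put $C'=I(x';Hx'+z)$. Then such an $x'$ exists and is an admissible input, $C$ and $C'$ are finite, and the capacity loss $\Delta C=C-C'$ equals $$\Delta C=-\frac12\sum_{i=1}^n\log(1-\mu_i^2),$$ where $\mu_1,\dots,\mu_n$ are the singular values, with multiplicity, of $\dfrac{n}{S+\operatorname{tr}(H^{-1}C_zH^{-H})}\,H^{-1}P_zH^{-T}$. In particular, $$0\le\Delta C<n\log\frac{2}{\sqrt3}.$$ -/

import Mathlib

open MeasureTheory ProbabilityTheory
open scoped Matrix

namespace ComplexChannel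

noncomputable section

/-- Mean vector `m = E[x]` of a random vector in `ℂⁿ` with law `μ`. -/
def meanVec {n : ℕ} (μ : Measure (Fin n → ℂ)) : Fin n → ℂ :=
  fun i => ∫ x, x i ∂μ

/-- Covariance matrix `C = E[(x - m)(x - m)ᴴ]` of a random vector with law `μ`. -/
def covMat {n : ℕ} (μ : Measure (Fin n → ℂ)) : Matrix (Fin n) (Fin n) ℂ :=
  Matrix.of fun i j => ∫ x, (x i - meanVec μ i) * star (x j - meanVec μ j) ∂μ

/-- Complementary covariance matrix `P = E[(x - m)(x - m)ᵀ]` of a random vector with law `μ`. -/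
def compCovMat {n : ℕ} (μ : Measure (Fin n → ℂ)) : Matrix (Fin n) (Fin n) ℂ :=
  Matrix.of fun i j => ∫ x, (x i - meanVec μ i) * (x j - meanVec μ j) ∂μ

/-- Euclidean operator norm `‖A‖₂` of a square complex matrix. -/
def opNorm {n : ℕ} (A : Matrix (Fin n) (Fin n) ℂ) : ℝ :=
  ‖Matrix.toEuclideanCLM (n := Fin n) (𝕜 := ℂ) A‖

/-- The `n` singular values of an `n × n` complex matrix, in decreasing order, repeated according
to multiplicity (those that vanish included). -/
def singVal {n : ℕ} (A : Matrix (Fin n) (Fin n) ℂ) (i : Fin n) : ℝ :=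
  (Matrix.toEuclideanLin A).singularValues i

/-- Probability density of a law with respect to Lebesgue measure. The measure `volume` on
`Fin n → ℂ` is Lebesgue measure on the `2 n` real and imaginary parts. -/
def pdf {E : Type*} [MeasureSpace E] (μ : Measure E) (x : E) : ℝ :=
  (μ.rnDeriv volume x).toReal

/-- The integrand `f_{x,y} log_b (f_{x,y} / (f_x f_y))` of the mutual information of a pair
`(x, y)` with joint law `ρ`. -/
def infoDensity {n m : ℕ} (b : ℝ) (ρ : Measure ((Fin n → ℂ) × (Fin m → ℂ)))
    (p : (Fin n → ℂ) × (Fin m → ℂ)) : ℝ :=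
  pdf ρ p * Real.logb b (pdf ρ p / (pdf ρ.fst p.1 * pdf ρ.snd p.2))

open Classical in
/-- Mutual information `I(x; y)`, to the base `b`, of a pair `(x, y)` whose joint law `ρ` has a
density. The negative part of the integrand is always integrable, so that the integral is `+∞`
when the integrand is not integrable. -/
def mutualInfo {n m : ℕ} (b : ℝ) (ρ : Measure ((Fin n → ℂ) × (Fin m → ℂ))) : EReal :=
  if Integrable (infoDensity b ρ) volume then ((∫ p, infoDensity b ρ p : ℝ) : EReal) else ⊤

/-- Joint law of the input `x` and the output `y = H x + z` when `x` has law `ν`, `z` has law `ζ`,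
and `x` and `z` are independent. -/
def jointLaw {n m : ℕ} (H : Matrix (Fin n) (Fin m) ℂ) (ζ : Measure (Fin n → ℂ))
    (ν : Measure (Fin m → ℂ)) : Measure ((Fin m → ℂ) × (Fin n → ℂ)) :=
  (ν.prod ζ).map fun p => (p.1, H *ᵥ p.1 + p.2)

/-- The admissible input laws: probability laws that have a density and satisfy the average power
constraint `E[xᴴ x] ≤ S`. -/
def admissible (m : ℕ) (S : ℝ) : Set (Measure (Fin m → ℂ)) :=
  {ν | IsProbabilityMeasure ν ∧ ν ≪ volume ∧
    ∫⁻ x, ENNReal.ofReal (∑ i, ‖x i‖ ^ 2) ∂ν ≤ ENNReal.ofReal S}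

/-- Capacity, to the base `b`, of the channel `y = H x + z` with noise law `ζ` under the average
power constraint `E[xᴴ x] ≤ S`. -/
def capacity {n m : ℕ} (b : ℝ) (H : Matrix (Fin n) (Fin m) ℂ) (ζ : Measure (Fin n → ℂ))
    (S : ℝ) : EReal :=
  ⨆ ν ∈ admissible m S, mutualInfo b (jointLaw H ζ ν)

/-- The total power `S + tr(H⁻¹ C H⁻ᴴ)`; the trace is real for Hermitian `C`. -/
def totalPower {n : ℕ} (H C : Matrix (Fin n) (Fin n) ℂ) (S : ℝ) : ℝ :=
  S + (H⁻¹ * C * (H⁻¹)ᴴ).trace.re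

/-- `ν` is the law of the input `x'` used by a transmitter that believes the zero-mean Gaussian
noise, of covariance matrix `C`, to be proper: zero-mean, Gaussian, with the water-filling
covariance matrix `(1/n) (S + tr(H⁻¹ C H⁻ᴴ)) I - H⁻¹ C H⁻ᴴ`, and proper. -/
def IsMismatchedInput {n : ℕ} (H C : Matrix (Fin n) (Fin n) ℂ) (S : ℝ)
    (ν : Measure (Fin n → ℂ)) : Prop :=
  IsGaussian ν ∧ meanVec ν = 0 ∧
    covMat ν = ((totalPower H C S / n : ℝ) : ℂ) • (1 : Matrix (Fin n) (Fin n) ℂ)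
      - H⁻¹ * C * (H⁻¹)ᴴ ∧
    compCovMat ν = 0

end

end ComplexChannel

namespace ComplexChannel

/-! Multiplying the output by `H⁻¹` and passing to real coordinates turns the channel into x + H⁻¹z
on ℝ²ⁿ. Write `W` for the real covariance matrix of H⁻¹z, and C, P for its complex covariance and
complementary covariance. By Gibbs' inequality (`integral_logRatio_le`) the rate of an input is at
most the mean of log q(z) − log g(y), where q is the noise density and g any positive probability
density on outputs, with equality when g is the true output density. Taking for g the Gaussian whose
real coordinates have covariance sI, s = (S + tr W)/(2n), gives a bound that depends on the input
only through E‖x + H⁻¹z‖² ≤ S + tr W = 2ns, so a single constant bounds all admissible inputs. It is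
attained by the Gaussian input of real covariance sI − W, provided that matrix is positive definite.

The power hypothesis provides this. A phase rotation of u shows |uᴴPū| ≤ uᴴCu
(`norm_complexCompCov_form_le`), hence W ≤ ‖C‖I, while S ≥ 2n‖C‖ and tr W > 0 force ‖C‖ < s.

The output of the mismatched input is Gaussian too; divided by H, it has complex covariance 2sI and
complementary covariance P. The two rates share the noise term, so the loss is half the logarithm of
s²ⁿ over the determinant of the real output covariance. In the augmented coordinates (v, v̄) this
determinant is s²ⁿ det(I − MᴴM) with M = P/(2s), that is, s²ⁿ ∏(1 − μᵢ²)
(`det_eq_of_complexCov_eq_smul`). Finally, the domination of P by C and the symmetry of P give ‖P‖ ≤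
‖C‖ (`normSqVec_mulVec_le`), so μᵢ ≤ ‖C‖/(2s) < 1/2, and each term of the loss lies below −½
log(3/4) = log(2/√3). -/

theorem map_withDensity_equiv {α β : Type*} [MeasurableSpace α] [MeasurableSpace β]
    (μ : Measure α) (e : α ≃ᵐ β) {f : α → ENNReal} (hf : Measurable f) :
    (μ.withDensity f).map e = (μ.map e).withDensity (f ∘ e.symm) := by
  ext s hs
  rw [Measure.map_apply e.measurable hs, withDensity_apply _ hs,
    withDensity_apply _ (e.measurable hs),
    setLIntegral_map hs (hf.comp e.symm.measurable) e.measurable]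
  simp

/-! ### Mutual information as the mean of a log-likelihood ratio; Gibbs' inequality -/

section Info

variable {E F : Type*} [MeasureSpace E] [MeasureSpace F]

theorem measurable_pdf (μ : Measure E) : Measurable (pdf μ) :=
  (Measure.measurable_rnDeriv _ _).ennreal_toReal

theorem pdf_nonneg (μ : Measure E) (x : E) : 0 ≤ pdf μ x := ENNReal.toReal_nonneg

theorem fst_absolutelyContinuous {ρ : Measure (E × F)} (hρ : ρ ≪ volume) : ρ.fst ≪ volume :=
  (hρ.map measurable_fst).trans Measure.quasiMeasurePreserving_fst.absolutelyContinuous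

theorem snd_absolutelyContinuous {ρ : Measure (E × F)} (hρ : ρ ≪ volume) : ρ.snd ≪ volume :=
  (hρ.map measurable_snd).trans Measure.quasiMeasurePreserving_snd.absolutelyContinuous

theorem ae_fst_of_ae {ρ : Measure (E × F)} {p : E → Prop} (h : ∀ᵐ x ∂ρ.fst, p x) :
    ∀ᵐ q ∂ρ, p q.1 := ae_of_ae_map measurable_fst.aemeasurable h

theorem ae_snd_of_ae {ρ : Measure (E × F)} {p : F → Prop} (h : ∀ᵐ x ∂ρ.snd, p x) :
    ∀ᵐ q ∂ρ, p q.2 := ae_of_ae_map measurable_snd.aemeasurable h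

theorem lintegral_pdf (μ : Measure E) [IsProbabilityMeasure μ] :
    ∫⁻ x, ENNReal.ofReal (pdf μ x) ≤ 1 := by
  calc ∫⁻ x, ENNReal.ofReal (pdf μ x) ≤ ∫⁻ x, μ.rnDeriv volume x :=
        lintegral_mono fun x => ENNReal.ofReal_toReal_le
    _ ≤ μ Set.univ := Measure.lintegral_rnDeriv_le
    _ = 1 := measure_univ

variable [SigmaFinite (volume : Measure E)]

theorem ae_pdf_pos (μ : Measure E) [SigmaFinite μ] (hμ : μ ≪ volume) :
    ∀ᵐ x ∂μ, 0 < pdf μ x := by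
  filter_upwards [Measure.rnDeriv_pos hμ, hμ.ae_le (Measure.rnDeriv_lt_top μ volume)] with x h1 h2
  exact ENNReal.toReal_pos h1.ne' h2.ne

/-- The density of `μ` cancels where it is positive. Equality can fail because `g` may charge the
set where that density vanishes, which the left side does not see. -/
theorem lintegral_div_pdf_le (μ : Measure E) [SigmaFinite μ] (hμ : μ ≪ volume) {g : E → ℝ}
    (hg : Measurable g) :
    ∫⁻ x, ENNReal.ofReal (g x / pdf μ x) ∂μ ≤ ∫⁻ x, ENNReal.ofReal (g x) := by
  have hm : Measurable fun x => ENNReal.ofReal (g x / pdf μ x) :=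
    (hg.div (measurable_pdf μ)).ennreal_ofReal
  rw [← lintegral_rnDeriv_mul hμ hm.aemeasurable]
  refine lintegral_mono_ae ?_
  filter_upwards [Measure.rnDeriv_lt_top μ volume] with x hx
  rcases eq_or_ne (μ.rnDeriv volume x) 0 with h0 | h0
  · simp [h0]
  · have hpos : 0 < pdf μ x := ENNReal.toReal_pos h0 hx.ne
    conv_lhs => rw [← ENNReal.ofReal_toReal hx.ne]
    change ENNReal.ofReal (pdf μ x) * _ ≤ _
    rw [← ENNReal.ofReal_mul hpos.le, mul_div_cancel₀ _ hpos.ne']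

theorem integrable_div_pdf (μ : Measure E) [SigmaFinite μ] (hμ : μ ≪ volume) {g : E → ℝ}
    (hg : Measurable g) (hg0 : ∀ x, 0 ≤ g x) (hg1 : ∫⁻ x, ENNReal.ofReal (g x) ≤ 1) :
    Integrable (fun x => g x / pdf μ x) μ ∧ ∫ x, g x / pdf μ x ∂μ ≤ 1 := by
  have h0 : ∀ x, 0 ≤ g x / pdf μ x := fun x => div_nonneg (hg0 x) (pdf_nonneg μ x)
  have h1 := (lintegral_div_pdf_le μ hμ hg).trans hg1
  have hm : Measurable fun x => g x / pdf μ x := hg.div (measurable_pdf μ)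
  refine ⟨⟨hm.aestronglyMeasurable, ?_⟩, ?_⟩
  · rw [hasFiniteIntegral_iff_ofReal (Filter.Eventually.of_forall h0)]
    exact h1.trans_lt ENNReal.one_lt_top
  · rw [integral_eq_lintegral_of_nonneg_ae (Filter.Eventually.of_forall h0)
      hm.aestronglyMeasurable]
    exact ENNReal.toReal_le_of_le_ofReal zero_le_one (by simpa using h1)

/-- The logarithm of the likelihood ratio whose mean is the mutual information. -/
noncomputable def logRatio (ρ : Measure (E × F)) (p : E × F) : ℝ :=
  Real.log (pdf ρ p / (pdf ρ.fst p.1 * pdf ρ.snd p.2))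

variable [SigmaFinite (volume : Measure F)]

/-- Replacing the output density by any other probability density increases the mean of the
logarithmic likelihood ratio. -/
theorem integral_logRatio_le (ρ : Measure (E × F)) [IsProbabilityMeasure ρ] (hρ : ρ ≪ volume)
    {g : F → ℝ} (hg : Measurable g) (hg0 : ∀ y, 0 < g y)
    (hg1 : ∫⁻ y, ENNReal.ofReal (g y) ≤ 1)
    (hK : Integrable (fun p => Real.log (pdf ρ p / (pdf ρ.fst p.1 * g p.2))) ρ) :
    Integrable (logRatio ρ) ρ ∧
      ∫ p, logRatio ρ p ∂ρ ≤ ∫ p, Real.log (pdf ρ p / (pdf ρ.fst p.1 * g p.2)) ∂ρ := by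
  have hm1 : Measurable (pdf ρ.fst) := measurable_pdf _
  have hm2 : Measurable (pdf ρ.snd) := measurable_pdf _
  have hm : Measurable (pdf ρ) := measurable_pdf _
  have hmu : Measurable fun p : E × F => pdf ρ.fst p.1 * pdf ρ.snd p.2 :=
    (hm1.comp measurable_fst).mul (hm2.comp measurable_snd)
  have hu1 : ∫⁻ p : E × F, ENNReal.ofReal (pdf ρ.fst p.1 * pdf ρ.snd p.2) ≤ 1 := by
    simp_rw [ENNReal.ofReal_mul (pdf_nonneg _ _)]
    rw [Measure.volume_eq_prod, lintegral_prod_mul hm1.ennreal_ofReal.aemeasurable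
      hm2.ennreal_ofReal.aemeasurable]
    exact mul_le_one' (lintegral_pdf _) (lintegral_pdf _)
  obtain ⟨hu, -⟩ := integrable_div_pdf ρ hρ hmu
    (fun p => mul_nonneg (pdf_nonneg _ _) (pdf_nonneg _ _)) hu1
  obtain ⟨ht, ht1⟩ := integrable_div_pdf ρ.snd (snd_absolutelyContinuous hρ) hg
    (fun y => (hg0 y).le) hg1
  have htm : AEStronglyMeasurable (fun y => g y / pdf ρ.snd y) ρ.snd := ht.1
  have ht' : Integrable (fun p : E × F => g p.2 / pdf ρ.snd p.2) ρ :=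
    ht.comp_measurable measurable_snd
  have ht1' : ∫ p : E × F, g p.2 / pdf ρ.snd p.2 ∂ρ ≤ 1 := by
    rwa [← integral_map (φ := Prod.snd) measurable_snd.aemeasurable htm]
  -- The bounds 1 − 1/t ≤ log t ≤ t − 1 sandwich the log-ratio between integrable functions. The
  -- lower one gives integrability without any entropy assumption on the marginals; the upper one is
  -- Gibbs' inequality, since g / f_y has mean at most 1.
  have key : ∀ᵐ p ∂ρ,
      1 - pdf ρ.fst p.1 * pdf ρ.snd p.2 / pdf ρ p ≤ logRatio ρ p ∧
      logRatio ρ p ≤ Real.log (pdf ρ p / (pdf ρ.fst p.1 * g p.2))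
        + (g p.2 / pdf ρ.snd p.2 - 1) := by
    filter_upwards [ae_pdf_pos ρ hρ, ae_fst_of_ae (ae_pdf_pos ρ.fst (fst_absolutelyContinuous hρ)),
      ae_snd_of_ae (ae_pdf_pos ρ.snd (snd_absolutelyContinuous hρ))] with p h0 h1 h2
    have hgp := hg0 p.2
    constructor
    · have := Real.one_sub_inv_le_log_of_pos (x := pdf ρ p / (pdf ρ.fst p.1 * pdf ρ.snd p.2))
        (by positivity)
      rwa [inv_div] at this
    · have h3 := Real.log_le_sub_one_of_pos (x := g p.2 / pdf ρ.snd p.2) (by positivity)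
      have h4 : logRatio ρ p = Real.log (pdf ρ p / (pdf ρ.fst p.1 * g p.2))
          + Real.log (g p.2 / pdf ρ.snd p.2) := by
        rw [logRatio, ← Real.log_mul (by positivity) (by positivity)]
        congr 1
        field_simp
      linarith
  have hLm : Measurable (logRatio ρ) := (hm.div hmu).log
  have hupper : Integrable (fun p : E × F => Real.log (pdf ρ p / (pdf ρ.fst p.1 * g p.2))
        + (g p.2 / pdf ρ.snd p.2 - 1)) ρ := hK.add (ht'.sub (integrable_const 1))
  have hLi : Integrable (logRatio ρ) ρ := by
    refine integrable_of_le_of_le hLm.aestronglyMeasurable (key.mono fun p h => h.1)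
      (key.mono fun p h => h.2) ((integrable_const 1).sub hu) hupper
  refine ⟨hLi, (integral_mono_ae hLi hupper (key.mono fun p h => h.2)).trans ?_⟩
  have h5 : ∫ p : E × F, (g p.2 / pdf ρ.snd p.2 - 1) ∂ρ
      = ∫ p : E × F, g p.2 / pdf ρ.snd p.2 ∂ρ - ∫ p : E × F, (1 : ℝ) ∂ρ :=
    integral_sub ht' (integrable_const 1)
  have h6 : ∫ p : E × F, (Real.log (pdf ρ p / (pdf ρ.fst p.1 * g p.2))
        + (g p.2 / pdf ρ.snd p.2 - 1)) ∂ρ = _ :=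
    integral_add hK (ht'.sub (integrable_const 1))
  rw [h6, h5]
  simp only [integral_const, probReal_univ, smul_eq_mul, mul_one]
  linarith

end Info

theorem integrable_pdf_mul {E : Type*} [MeasureSpace E] [SigmaFinite (volume : Measure E)]
    (μ : Measure E) [SigmaFinite μ] (hμ : μ ≪ volume) {f : E → ℝ} (hf : Integrable f μ) :
    Integrable (fun x => pdf μ x * f x) volume ∧ ∫ x, pdf μ x * f x = ∫ x, f x ∂μ :=
  ⟨(integrable_rnDeriv_smul_iff hμ).2 hf, integral_rnDeriv_smul hμ⟩

/-- Integrability of the log-ratio under `ρ` selects the finite branch of the definition, and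
changing base divides by `Real.log b`. -/
theorem mutualInfo_eq {n m : ℕ} (b : ℝ) (ρ : Measure ((Fin n → ℂ) × (Fin m → ℂ)))
    [IsProbabilityMeasure ρ] (hρ : ρ ≪ volume) (hL : Integrable (logRatio ρ) ρ) :
    mutualInfo b ρ = ((∫ p, logRatio ρ p ∂ρ) / Real.log b : ℝ) := by
  obtain ⟨h1, h2⟩ := integrable_pdf_mul ρ hρ (hL.div_const (Real.log b))
  have h3 : infoDensity b ρ = fun p => pdf ρ p * (logRatio ρ p / Real.log b) := rfl
  rw [mutualInfo, if_pos (h3 ▸ h1), h3, h2, integral_div]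

/-! ### The additive-noise channel as a volume-preserving shear -/

section Shear

variable {E F : Type*} [MeasurableSpace E] [MeasurableSpace F] [AddGroup F] [MeasurableAdd₂ F]
  [MeasurableNeg F]

/-- The shear `(x, z) ↦ (x, f x + z)`. -/
def shear (f : E → F) (hf : Measurable f) : E × F ≃ᵐ E × F where
  toFun p := (p.1, f p.1 + p.2)
  invFun p := (p.1, -f p.1 + p.2)
  left_inv p := by simp
  right_inv p := by simp
  measurable_toFun := measurable_fst.prodMk ((hf.comp measurable_fst).add measurable_snd)
  measurable_invFun := measurable_fst.prodMk ((hf.comp measurable_fst).neg.add measurable_snd)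

/-- On each fibre over x the shear is a translation, which preserves `ν`. -/
theorem map_shear_prod (f : E → F) (hf : Measurable f) (μ : Measure E) (ν : Measure F) [SFinite μ]
    [SigmaFinite ν] [ν.IsAddLeftInvariant] :
    (μ.prod ν).map (shear f hf) = μ.prod ν := by
  have := (MeasurePreserving.id μ).skew_product (g := fun x z => f x + z) (μc := ν) (μd := ν)
    ((hf.comp measurable_fst).add measurable_snd)
    (Filter.Eventually.of_forall fun x => map_add_left_eq_self ν (f x))
  exact this.map_eq

end Shear

/-- Law of the pair `(x, f x + z)`: it has the density `p(x) q(y - f x)`. -/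
theorem map_shear_withDensity {E F : Type*} [MeasureSpace E] [MeasureSpace F]
    [SigmaFinite (volume : Measure E)] [SigmaFinite (volume : Measure F)]
    [AddGroup F] [MeasurableAdd₂ F] [MeasurableNeg F]
    [(volume : Measure F).IsAddLeftInvariant] (f : E → F) (hf : Measurable f)
    {p : E → ENNReal} {q : F → ENNReal} (hp : Measurable p) (hq : Measurable q)
    [SFinite ((volume : Measure F).withDensity q)] :
    (((volume : Measure E).withDensity p).prod ((volume : Measure F).withDensity q)).map
      (shear f hf) = (volume : Measure (E × F)).withDensity
        fun r => p r.1 * q (-f r.1 + r.2) := by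
  rw [prod_withDensity hp hq, map_withDensity_equiv _ _ (by fun_prop), map_shear_prod]
  rfl

theorem pdf_withDensity_ofReal {E : Type*} [MeasureSpace E] [SigmaFinite (volume : Measure E)]
    {q : E → ℝ} (hq : Measurable q) (hq0 : ∀ x, 0 ≤ q x) :
    pdf ((volume : Measure E).withDensity fun x => ENNReal.ofReal (q x)) =ᵐ[volume] q := by
  filter_upwards [Measure.rnDeriv_withDensity volume hq.ennreal_ofReal] with x hx
  rw [pdf, hx, ENNReal.toReal_ofReal (hq0 x)]

section AdditiveNoise

variable {E F : Type*} [MeasureSpace E] [MeasureSpace F]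
    [SigmaFinite (volume : Measure E)] [SigmaFinite (volume : Measure F)]
    [AddGroup F] [MeasurableAdd₂ F] [MeasurableNeg F]
    [(volume : Measure F).IsAddLeftInvariant]
    {f : E → F} (hf : Measurable f) {q : F → ℝ} (hq : Measurable q) (hq0 : ∀ x, 0 < q x)
    (ν : Measure E) [IsProbabilityMeasure ν] (hν : ν ≪ volume)
    (ζ : Measure F) [IsProbabilityMeasure ζ]
    (hζ : ζ = (volume : Measure F).withDensity fun x => ENNReal.ofReal (q x))

include hq hν hζ in
theorem map_shear_eq_withDensity :
    (ν.prod ζ).map (shear f hf) = (volume : Measure (E × F)).withDensity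
        fun r => ν.rnDeriv volume r.1 * ENNReal.ofReal (q (-f r.1 + r.2)) := by
  have : SFinite ((volume : Measure F).withDensity fun x => ENNReal.ofReal (q x)) := by
    rw [← hζ]; infer_instance
  conv_lhs => rw [hζ, ← Measure.withDensity_rnDeriv_eq ν volume hν]
  exact map_shear_withDensity f hf (Measure.measurable_rnDeriv _ _) hq.ennreal_ofReal

omit [SigmaFinite (volume : Measure E)] [SigmaFinite (volume : Measure F)]
    [(volume : Measure F).IsAddLeftInvariant] [IsProbabilityMeasure ν] in
theorem fst_map_shear : ((ν.prod ζ).map (shear f hf)).fst = ν := by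
  rw [Measure.fst, Measure.map_map measurable_fst (shear f hf).measurable]
  exact Measure.fst_prod

include hq hq0 hν hζ in
-- The joint density is p(x) q(y − f x), so the input density cancels. The cancellation needs p(x) >
-- 0, hence holds only almost everywhere for the joint law.
theorem log_pdf_map_shear {g : F → ℝ} (hg0 : ∀ y, 0 < g y) :
    ∀ᵐ r ∂((ν.prod ζ).map (shear f hf)),
      Real.log (pdf ((ν.prod ζ).map (shear f hf)) r / (pdf ν r.1 * g r.2))
        = Real.log (q (-f r.1 + r.2)) - Real.log (g r.2) := by
  have hρ := map_shear_eq_withDensity hf hq ν hν ζ hζ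
  set ρ := (ν.prod ζ).map (shear f hf) with hρd
  have : IsProbabilityMeasure ρ :=
    Measure.isProbabilityMeasure_map (shear f hf).measurable.aemeasurable
  have hac : ρ ≪ volume := hρ ▸ withDensity_absolutelyContinuous _ _
  have h1 : ρ.rnDeriv volume =ᵐ[volume]
      fun r => ν.rnDeriv volume r.1 * ENNReal.ofReal (q (-f r.1 + r.2)) := by
    conv_lhs => rw [hρ]
    exact Measure.rnDeriv_withDensity volume (by fun_prop)
  have h2 : ∀ᵐ r ∂ρ, 0 < pdf ν r.1 :=
    by
    have h := ae_pdf_pos ν hν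
    rw [← fst_map_shear hf ν ζ] at h
    have h' := ae_fst_of_ae h
    rwa [fst_map_shear hf ν ζ] at h'
  filter_upwards [hac.ae_le h1, h2] with r h1 h2
  have h3 : pdf ρ r = pdf ν r.1 * q (-f r.1 + r.2) := by
    rw [pdf, h1, ENNReal.toReal_mul, ENNReal.toReal_ofReal (hq0 _).le, pdf]
  rw [h3, mul_div_mul_left _ _ h2.ne', Real.log_div (hq0 _).ne' (hg0 _).ne']

include hq hq0 hν hζ in
-- Gibbs' inequality pulled back through the shear, so that the integral is over the independent
-- pair (x, z). The last clause is the equality case, which evaluates rates exactly once the output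
-- law is known.
theorem integral_logRatio_additive_le {g : F → ℝ} (hg : Measurable g) (hg0 : ∀ y, 0 < g y)
    (hg1 : ∫⁻ y, ENNReal.ofReal (g y) ≤ 1)
    (hint : Integrable (fun p : E × F => Real.log (q p.2) - Real.log (g (f p.1 + p.2)))
      (ν.prod ζ)) :
    Integrable (logRatio ((ν.prod ζ).map (shear f hf))) ((ν.prod ζ).map (shear f hf)) ∧
    ∫ r, logRatio ((ν.prod ζ).map (shear f hf)) r ∂((ν.prod ζ).map (shear f hf))
      ≤ ∫ p, (Real.log (q p.2) - Real.log (g (f p.1 + p.2))) ∂(ν.prod ζ) ∧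
    (((ν.prod ζ).map (shear f hf)).snd
        = (volume : Measure F).withDensity (fun x => ENNReal.ofReal (g x)) →
      ∫ r, logRatio ((ν.prod ζ).map (shear f hf)) r ∂((ν.prod ζ).map (shear f hf))
      = ∫ p, (Real.log (q p.2) - Real.log (g (f p.1 + p.2))) ∂(ν.prod ζ)) := by
  have hρ := map_shear_eq_withDensity hf hq ν hν ζ hζ
  have hK := log_pdf_map_shear hf hq hq0 ν hν ζ hζ hg0
  have hfst := fst_map_shear hf ν ζ
  have hchange : ∫ r, (Real.log (q (-f r.1 + r.2)) - Real.log (g r.2))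
      ∂((ν.prod ζ).map (shear f hf))
      = ∫ p, (Real.log (q p.2) - Real.log (g (f p.1 + p.2))) ∂(ν.prod ζ) := by
    rw [integral_map_equiv]
    simp [shear]
  have hint' : Integrable (fun r => Real.log (q (-f r.1 + r.2)) - Real.log (g r.2))
      ((ν.prod ζ).map (shear f hf)) := by
    rw [integrable_map_equiv]
    simpa [shear, Function.comp_def] using hint
  set ρ := (ν.prod ζ).map (shear f hf) with hρd
  have : IsProbabilityMeasure ρ :=
    Measure.isProbabilityMeasure_map (shear f hf).measurable.aemeasurable
  have hac : ρ ≪ volume := hρ ▸ withDensity_absolutelyContinuous _ _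
  have hmain := integral_logRatio_le ρ hac hg hg0 hg1
    (by rw [hfst]; exact hint'.congr (hK.mono fun r h => h.symm))
  rw [hfst, integral_congr_ae hK, hchange] at hmain
  refine ⟨hmain.1, hmain.2, fun hsnd => ?_⟩
  rw [← hchange, ← integral_congr_ae hK]
  refine integral_congr_ae ?_
  have h1 : ∀ᵐ y ∂ρ.snd, pdf ρ.snd y = g y := by
    refine (snd_absolutelyContinuous hac).ae_le ?_
    rw [hsnd]
    exact pdf_withDensity_ofReal hg fun y => (hg0 y).le
  filter_upwards [ae_snd_of_ae h1] with r hr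
  rw [logRatio, hr, hfst]

end AdditiveNoise

/-! ### Centred Gaussian laws on real coordinate space and their densities -/

section RealGaussian

variable (ι : Type*) [Fintype ι]

/-- The standard Gaussian law on `ι → ℝ`. -/
noncomputable def stdGauss : Measure (ι → ℝ) := Measure.pi fun _ => gaussianReal 0 1

instance : IsProbabilityMeasure (stdGauss ι) := by
  unfold stdGauss; infer_instance

theorem stdGauss_eq_map : stdGauss ι =
    (stdGaussian (EuclideanSpace ℝ ι)).map (EuclideanSpace.equiv ι ℝ) := by
  rw [← map_pi_eq_stdGaussian, Measure.map_map (by fun_prop) (by fun_prop)]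
  exact Measure.map_id.symm

instance isGaussian_stdGauss : IsGaussian (stdGauss ι) := by
  rw [stdGauss_eq_map]; infer_instance

variable {ι}

theorem memLp_coord (μ : Measure (ι → ℝ)) [IsGaussian μ] (a : ι) :
    MemLp (fun x : ι → ℝ => x a) 2 μ :=
  IsGaussian.memLp_dual μ (ContinuousLinearMap.proj a) 2 (by simp)

theorem integral_coord_stdGauss (a : ι) : ∫ x, x a ∂(stdGauss ι) = 0 := by
  have h : (stdGauss ι).map (Function.eval a) = gaussianReal 0 1 :=
    (measurePreserving_eval (fun _ : ι => gaussianReal 0 1) a).map_eq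
  have := integral_map (μ := stdGauss ι) (φ := Function.eval a) (f := fun x : ℝ => x)
    (measurable_pi_apply a).aemeasurable (by fun_prop)
  rw [h, integral_id_gaussianReal] at this
  exact this.symm

theorem integral_coord_mul_stdGauss [DecidableEq ι] (a b : ι) :
    ∫ x, x a * x b ∂(stdGauss ι) = (1 : Matrix ι ι ℝ) a b := by
  have h := covariance_eval_multivariateGaussian (μ := 0) (S := (1 : Matrix ι ι ℝ))
    Matrix.PosSemidef.one a b
  rw [multivariateGaussian_zero_one] at h
  have hm : ∀ c : ι, MemLp (fun x : EuclideanSpace ℝ ι => x c) 2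
      (stdGaussian (EuclideanSpace ℝ ι)) := fun c =>
    IsGaussian.memLp_dual _ (EuclideanSpace.proj c) 2 (by simp)
  have h0 := integral_coord_stdGauss b
  have hc : ∀ c : ι, Measurable fun x : ι → ℝ => x c := measurable_pi_apply
  have hab : Measurable fun x : ι → ℝ => x a * x b := (hc a).mul (hc b)
  rw [stdGauss_eq_map, integral_map (by fun_prop) (hc b).aestronglyMeasurable] at h0
  rw [covariance_eq_sub (hm a) (hm b)] at h
  rw [stdGauss_eq_map, integral_map (by fun_prop) hab.aestronglyMeasurable, ← h]
  have h0' : ∫ x : EuclideanSpace ℝ ι, x b ∂(stdGaussian (EuclideanSpace ℝ ι)) = 0 := h0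
  rw [h0', mul_zero, sub_zero]
  rfl

/-- The standard Gaussian density on `ι → ℝ`. -/
noncomputable def stdDensity (x : ι → ℝ) : ℝ := ∏ i, gaussianPDFReal 0 1 (x i)

theorem measurable_stdDensity : Measurable (stdDensity (ι := ι)) := by
  unfold stdDensity
  have := measurable_gaussianPDFReal 0 1
  fun_prop

theorem stdDensity_pos (x : ι → ℝ) : 0 < stdDensity x :=
  Finset.prod_pos fun _ _ => gaussianPDFReal_pos _ _ _ one_ne_zero

theorem log_stdDensity (x : ι → ℝ) :
    Real.log (stdDensity x)
      = Fintype.card ι * Real.log (√(2 * Real.pi))⁻¹ - (∑ i, x i ^ 2) / 2 := by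
  rw [stdDensity, Real.log_prod fun i _ => (gaussianPDFReal_pos _ _ _ one_ne_zero).ne']
  have : ∀ i, Real.log (gaussianPDFReal 0 1 (x i))
      = Real.log (√(2 * Real.pi))⁻¹ - x i ^ 2 / 2 := by
    intro i
    rw [gaussianPDFReal, Real.log_mul (by positivity) (Real.exp_pos _).ne', Real.log_exp]
    simp
    ring
  simp_rw [this, Finset.sum_sub_distrib, ← Finset.sum_div]
  simp

theorem stdGauss_eq_withDensity :
    stdGauss ι = (volume : Measure (ι → ℝ)).withDensity
      fun x => ENNReal.ofReal (stdDensity x) := by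
  refine Measure.pi_eq fun s hs => ?_
  rw [withDensity_apply _ (MeasurableSet.univ_pi hs), volume_pi, Measure.restrict_pi_pi,
    ← ofReal_integral_eq_lintegral_ofReal]
  · simp_rw [stdDensity]
    rw [integral_fintype_prod_eq_prod (fun _ => gaussianPDFReal 0 1),
      ENNReal.ofReal_prod_of_nonneg fun i _ =>
        integral_nonneg fun x => gaussianPDFReal_nonneg 0 1 x]
    exact Finset.prod_congr rfl fun i _ =>
      (gaussianReal_apply_eq_integral 0 one_ne_zero (s i)).symm
  · exact Integrable.fintype_prod fun i => (integrable_gaussianPDFReal 0 1).restrict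
  · exact Filter.Eventually.of_forall fun x => (stdDensity_pos x).le

variable [DecidableEq ι]

theorem dual_apply_eq_sum (L : StrongDual ℝ (ι → ℝ)) (x : ι → ℝ) :
    L x = ∑ a, L (Pi.single a 1) * x a := by
  conv_lhs => rw [pi_eq_sum_univ' x]
  rw [map_sum]
  exact Finset.sum_congr rfl fun a _ => by rw [map_smul, smul_eq_mul, mul_comm]

/-- Expresses the second moment of every functional through those of the coordinates; for a centred
Gaussian law these determine the characteristic function. -/
theorem integral_dual_sq (μ : Measure (ι → ℝ)) [IsGaussian μ] (L : StrongDual ℝ (ι → ℝ)) :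
    ∫ x, L x ^ 2 ∂μ
      = ∑ a, ∑ b, L (Pi.single a 1) * L (Pi.single b 1) * ∫ x, x a * x b ∂μ := by
  have hi : ∀ a b, Integrable (fun x : ι → ℝ => x a * x b) μ := fun a b =>
    (memLp_coord μ a).integrable_mul (memLp_coord μ b)
  have : ∀ x, L x ^ 2
      = ∑ a, ∑ b, L (Pi.single a 1) * L (Pi.single b 1) * (x a * x b) := by
    intro x
    rw [dual_apply_eq_sum L x, sq, Finset.sum_mul_sum]
    exact Finset.sum_congr rfl fun a _ => Finset.sum_congr rfl fun b _ => by ring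
  simp_rw [this]
  rw [integral_finsetSum _ fun a _ => integrable_finsetSum _ fun b _ => (hi a b).const_mul _]
  refine Finset.sum_congr rfl fun a _ => ?_
  rw [integral_finsetSum _ fun b _ => (hi a b).const_mul _]
  exact Finset.sum_congr rfl fun b _ => integral_const_mul _ _

theorem integral_dual_eq_zero (μ : Measure (ι → ℝ)) [IsGaussian μ] (h : ∀ a, ∫ x, x a ∂μ = 0)
    (L : StrongDual ℝ (ι → ℝ)) : ∫ x, L x ∂μ = 0 := by
  rw [integral_congr_ae (Filter.Eventually.of_forall (dual_apply_eq_sum L)),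
    integral_finsetSum _ fun a _ => ((memLp_coord μ a).integrable (by simp)).const_mul _]
  exact Finset.sum_eq_zero fun a _ => by rw [integral_const_mul, h, mul_zero]

/-- Centred Gaussian laws with the same second moments coincide. -/
theorem gaussian_ext (μ ν : Measure (ι → ℝ)) [IsGaussian μ] [IsGaussian ν]
    (hμ : ∀ a, ∫ x, x a ∂μ = 0) (hν : ∀ a, ∫ x, x a ∂ν = 0)
    (h : ∀ a b, ∫ x, x a * x b ∂μ = ∫ x, x a * x b ∂ν) : μ = ν := by
  refine Measure.ext_of_charFunDual (funext fun L => ?_)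
  have hm := integral_dual_eq_zero μ hμ L
  have hn := integral_dual_eq_zero ν hν L
  rw [IsGaussian.charFunDual_eq, IsGaussian.charFunDual_eq, integral_complex_ofReal,
    integral_complex_ofReal, hm, hn,
    variance_of_integral_eq_zero (by fun_prop) hm, variance_of_integral_eq_zero (by fun_prop) hn,
    integral_dual_sq, integral_dual_sq]
  simp_rw [h]

/-- The centred Gaussian law with covariance matrix `A Aᵀ`. -/
noncomputable def gaussOf (A : Matrix ι ι ℝ) : Measure (ι → ℝ) := (stdGauss ι).map (A *ᵥ ·)

theorem gaussOf_eq_map_clm (A : Matrix ι ι ℝ) :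
    gaussOf A = (stdGauss ι).map (LinearMap.toContinuousLinearMap (Matrix.toLin' A)) := rfl

instance isGaussian_gaussOf (A : Matrix ι ι ℝ) : IsGaussian (gaussOf A) := by
  rw [gaussOf_eq_map_clm]; infer_instance

theorem measurable_mulVec {α β : Type*} [Fintype α] [Fintype β] (A : Matrix β α ℝ) :
    Measurable (A *ᵥ ·) := by
  have : Continuous (A *ᵥ ·) := by fun_prop
  exact this.measurable

theorem integral_coord_gaussOf (A : Matrix ι ι ℝ) (a : ι) : ∫ x, x a ∂(gaussOf A) = 0 := by
  rw [gaussOf, integral_map (measurable_mulVec A).aemeasurable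
    (measurable_pi_apply a).aestronglyMeasurable]
  exact integral_dual_eq_zero (stdGauss ι) integral_coord_stdGauss
    ((ContinuousLinearMap.proj a).comp (LinearMap.toContinuousLinearMap (Matrix.toLin' A)))

theorem integral_coord_mul_gaussOf (A : Matrix ι ι ℝ) (a b : ι) :
    ∫ x, x a * x b ∂(gaussOf A) = (A * Aᵀ) a b := by
  have hab : Measurable fun x : ι → ℝ => x a * x b :=
    (measurable_pi_apply a).mul (measurable_pi_apply b)
  rw [gaussOf, integral_map (measurable_mulVec A).aemeasurable hab.aestronglyMeasurable]
  have hi : ∀ c d, Integrable (fun x : ι → ℝ => x c * x d) (stdGauss ι) := fun c d =>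
    (memLp_coord _ c).integrable_mul (memLp_coord _ d)
  have : ∀ x : ι → ℝ, (A *ᵥ x) a * (A *ᵥ x) b
      = ∑ c, ∑ d, A a c * A b d * (x c * x d) := by
    intro x
    rw [Matrix.mulVec, Matrix.mulVec, dotProduct, dotProduct, Finset.sum_mul_sum]
    exact Finset.sum_congr rfl fun c _ => Finset.sum_congr rfl fun d _ => by ring
  simp_rw [this]
  rw [integral_finsetSum _ fun a _ => integrable_finsetSum _ fun b _ => (hi a b).const_mul _]
  have h2 : ∀ c, ∫ x, ∑ d, A a c * A b d * (x c * x d) ∂(stdGauss ι)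
      = ∑ d, A a c * A b d * (1 : Matrix ι ι ℝ) c d := by
    intro c
    rw [integral_finsetSum _ fun b _ => (hi c b).const_mul _]
    simp_rw [integral_const_mul, integral_coord_mul_stdGauss]
  simp_rw [h2]
  simp [Matrix.mul_apply, Matrix.one_apply]

-- The symmetric square root of `S` serves as `A`.
open scoped MatrixOrder in
theorem exists_mul_transpose_eq {S : Matrix ι ι ℝ} (hS : S.PosDef) :
    ∃ A : Matrix ι ι ℝ, A * Aᵀ = S ∧ A.det ≠ 0 := by
  have h : CFC.sqrt S * CFC.sqrt S = S := CFC.sqrt_mul_sqrt_self _ hS.posSemidef.nonneg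
  have h2 : IsSelfAdjoint (CFC.sqrt S) := (CFC.sqrt_nonneg S).isSelfAdjoint
  refine ⟨CFC.sqrt S, ?_, fun h0 => ?_⟩
  · have h3 : (CFC.sqrt S)ᵀ = CFC.sqrt S := by
      rw [← Matrix.conjTranspose_eq_transpose_of_trivial]; exact h2
    rw [h3, h]
  · have := hS.det_pos
    rw [← h, Matrix.det_mul, h0] at this
    simp at this

theorem exists_eq_gaussOf (μ : Measure (ι → ℝ)) [IsGaussian μ] (hμ : ∀ a, ∫ x, x a ∂μ = 0)
    {S : Matrix ι ι ℝ} (hS : S.PosDef) (h : ∀ a b, ∫ x, x a * x b ∂μ = S a b) :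
    ∃ A : Matrix ι ι ℝ, A * Aᵀ = S ∧ A.det ≠ 0 ∧ μ = gaussOf A := by
  obtain ⟨A, hA, hdet⟩ := exists_mul_transpose_eq hS
  refine ⟨A, hA, hdet, gaussian_ext μ (gaussOf A) hμ (integral_coord_gaussOf A) fun a b => ?_⟩
  rw [h, integral_coord_mul_gaussOf, hA]

/-- Density of the law of `Ψ (A g)`, where `g` is standard Gaussian and `Ψ` scales volumes by
`1 / κ`. -/
noncomputable def gaussDensity {E : Type*} (Φ : E → ι → ℝ) (κ : ℝ) (A : Matrix ι ι ℝ) (y : E) : ℝ :=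
  κ * |A.det|⁻¹ * stdDensity (A⁻¹ *ᵥ Φ y)

theorem gaussDensity_pos {E : Type*} (Φ : E → ι → ℝ) {κ : ℝ} (hκ : 0 < κ) {A : Matrix ι ι ℝ}
    (hA : A.det ≠ 0) (y : E) : 0 < gaussDensity Φ κ A y :=
  mul_pos (mul_pos hκ (inv_pos.2 (abs_pos.2 hA))) (stdDensity_pos _)

theorem measurable_gaussDensity {E : Type*} [MeasurableSpace E] {Φ : E → ι → ℝ}
    (hΦ : Measurable Φ) (κ : ℝ) (A : Matrix ι ι ℝ) : Measurable (gaussDensity Φ κ A) :=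
  measurable_const.mul (measurable_stdDensity.comp ((measurable_mulVec A⁻¹).comp hΦ))

theorem log_gaussDensity {E : Type*} (Φ : E → ι → ℝ) {κ : ℝ} (hκ : 0 < κ) {A : Matrix ι ι ℝ}
    (hA : A.det ≠ 0) (y : E) :
    Real.log (gaussDensity Φ κ A y) = Real.log κ - Real.log |A.det|
      + Fintype.card ι * Real.log (√(2 * Real.pi))⁻¹ - (∑ i, (A⁻¹ *ᵥ Φ y) i ^ 2) / 2 := by
  have h1 : 0 < |A.det| := abs_pos.2 hA
  rw [gaussDensity, Real.log_mul (by positivity) (stdDensity_pos _).ne',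
    Real.log_mul hκ.ne' (by positivity), Real.log_inv, log_stdDensity]
  ring

theorem gaussOf_eq_withDensity {A : Matrix ι ι ℝ} (hA : A.det ≠ 0) :
    gaussOf A = (volume : Measure (ι → ℝ)).withDensity
      fun x => ENNReal.ofReal (gaussDensity id 1 A x) := by
  have hAu : IsUnit A.det := isUnit_iff_ne_zero.2 hA
  let e : (ι → ℝ) ≃ᵐ (ι → ℝ) :=
    { toFun := (A *ᵥ ·)
      invFun := (A⁻¹ *ᵥ ·)
      left_inv := fun x => by simp [Matrix.nonsing_inv_mul _ hAu]
      right_inv := fun x => by simp [Matrix.mul_nonsing_inv _ hAu]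
      measurable_toFun := measurable_mulVec A
      measurable_invFun := measurable_mulVec A⁻¹ }
  have he : (volume : Measure (ι → ℝ)).map e = ENNReal.ofReal |A.det|⁻¹ • volume := by
    rw [← abs_inv]
    exact Real.map_matrix_volume_pi_eq_smul_volume_pi hA
  have h1 : gaussOf A = (stdGauss ι).map e := rfl
  rw [h1, stdGauss_eq_withDensity,
    map_withDensity_equiv _ _ measurable_stdDensity.ennreal_ofReal, he,
    withDensity_smul_measure, ← withDensity_smul _ (by
      exact (measurable_stdDensity.ennreal_ofReal.comp e.symm.measurable))]
  congr 1
  ext x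
  simp only [Pi.smul_apply, Function.comp_apply, smul_eq_mul, gaussDensity, one_mul]
  rw [ENNReal.ofReal_mul (by positivity)]
  rfl

/-- Density of the image of a Gaussian law under a linear isomorphism. -/
theorem exists_map_gaussOf_eq_withDensity {E : Type*} [NormedAddCommGroup E] [NormedSpace ℝ E]
    [FiniteDimensional ℝ E] [MeasureSpace E] [BorelSpace E]
    [(volume : Measure E).IsAddHaarMeasure] (Ψ : (ι → ℝ) ≃L[ℝ] E) :
    ∃ κ : ℝ, 0 < κ ∧ ∀ A : Matrix ι ι ℝ, A.det ≠ 0 →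
      (gaussOf A).map Ψ = (volume : Measure E).withDensity
        fun y => ENNReal.ofReal (gaussDensity Ψ.symm κ A y) := by
  have : SecondCountableTopology E := Ψ.symm.toHomeomorph.secondCountableTopology
  have hH : ((volume : Measure (ι → ℝ)).map Ψ).IsAddHaarMeasure :=
    ContinuousLinearEquiv.isAddHaarMeasure_map Ψ volume
  -- This volume factor is never computed: it depends on `Ψ` but not on `A`, so it cancels between
  -- the noise and output densities.
  set c := Measure.addHaarScalarFactor ((volume : Measure (ι → ℝ)).map Ψ) volume with hc
  have hcpos : 0 < c := Measure.addHaarScalarFactor_pos_of_isAddHaarMeasure _ _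
  have hmap : (volume : Measure (ι → ℝ)).map Ψ = c • (volume : Measure E) :=
    Measure.isAddLeftInvariant_eq_smul _ _
  refine ⟨c, hcpos, fun A hA => ?_⟩
  let e := Ψ.toHomeomorph.toMeasurableEquiv
  have he : (volume : Measure (ι → ℝ)).map e = (c : ENNReal) • (volume : Measure E) := hmap
  have h1 : (gaussOf A).map Ψ = (gaussOf A).map e := rfl
  have hm : Measurable (gaussDensity id 1 A) := measurable_gaussDensity measurable_id 1 A
  rw [h1, gaussOf_eq_withDensity hA, map_withDensity_equiv _ _ hm.ennreal_ofReal, he,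
    withDensity_smul_measure, ← withDensity_smul _ (by
      exact (hm.ennreal_ofReal.comp e.symm.measurable))]
  congr 1
  ext x
  simp only [Pi.smul_apply, Function.comp_apply, smul_eq_mul, gaussDensity, one_mul, mul_assoc]
  rw [ENNReal.ofReal_mul (p := (c : ℝ)) c.2, ENNReal.ofReal_coe_nnreal]
  rfl

end RealGaussian

/-! ### Quadratic forms, operator norm and singular values -/

section Norms

variable {n : ℕ}

/-- Squared Euclidean norm of a complex vector. -/
noncomputable def normSqVec {n : ℕ} (u : Fin n → ℂ) : ℝ := ∑ i, ‖u i‖ ^ 2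

theorem normSqVec_nonneg (u : Fin n → ℂ) : 0 ≤ normSqVec u :=
  Finset.sum_nonneg fun _ _ => by positivity

theorem normSqVec_eq_norm_sq (u : Fin n → ℂ) : normSqVec u = ‖WithLp.toLp 2 u‖ ^ 2 := by
  rw [EuclideanSpace.norm_sq_eq]
  rfl

theorem normSqVec_pos {u : Fin n → ℂ} (hu : u ≠ 0) : 0 < normSqVec u := by
  rw [normSqVec_eq_norm_sq]
  have : WithLp.toLp 2 u ≠ 0 := by simpa using hu
  positivity

theorem normSqVec_star (u : Fin n → ℂ) : normSqVec (star u) = normSqVec u := by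
  simp [normSqVec]

theorem star_dotProduct_self (u : Fin n → ℂ) : star u ⬝ᵥ u = (normSqVec u : ℂ) := by
  simp only [dotProduct, normSqVec, Pi.star_apply, RCLike.star_def, Complex.ofReal_sum]
  refine Finset.sum_congr rfl fun i _ => ?_
  rw [mul_comm, Complex.mul_conj, Complex.normSq_eq_norm_sq]

theorem normSqVec_smul (c : ℂ) (u : Fin n → ℂ) : normSqVec (c • u) = ‖c‖ ^ 2 * normSqVec u := by
  simp [normSqVec, Finset.mul_sum, mul_pow]

theorem opNorm_nonneg (A : Matrix (Fin n) (Fin n) ℂ) : 0 ≤ opNorm A := norm_nonneg _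

theorem norm_star_dotProduct_mulVec_le (A : Matrix (Fin n) (Fin n) ℂ) {u v : Fin n → ℂ}
    (h : normSqVec u = normSqVec v) : ‖star u ⬝ᵥ A *ᵥ v‖ ≤ opNorm A * normSqVec v := by
  have h1 : star u ⬝ᵥ A *ᵥ v
      = inner ℂ (WithLp.toLp 2 u)
        (Matrix.toEuclideanCLM (n := Fin n) (𝕜 := ℂ) A (WithLp.toLp 2 v)) := by
    rw [Matrix.toEuclideanCLM_toLp, EuclideanSpace.inner_toLp_toLp, dotProduct_comm]
  have h2 : ‖WithLp.toLp 2 u‖ = ‖WithLp.toLp 2 v‖ := by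
    rw [normSqVec_eq_norm_sq, normSqVec_eq_norm_sq] at h
    exact (sq_eq_sq₀ (norm_nonneg _) (norm_nonneg _)).1 h
  rw [h1]
  refine (norm_inner_le_norm _ _).trans ?_
  rw [normSqVec_eq_norm_sq, h2]
  calc _ ≤ ‖WithLp.toLp 2 v‖ * (opNorm A * ‖WithLp.toLp 2 v‖) :=
        mul_le_mul_of_nonneg_left (ContinuousLinearMap.le_opNorm _ _) (norm_nonneg _)
    _ = _ := by ring

/-- A complex symmetric matrix is bounded by its values on the vectors `(u, ū)`. -/
theorem normSqVec_mulVec_le {P : Matrix (Fin n) (Fin n) ℂ} (hP : Pᵀ = P) {c : ℝ} (hc : 0 ≤ c)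
    (h : ∀ u : Fin n → ℂ, ‖star u ⬝ᵥ P *ᵥ star u‖ ≤ c * normSqVec u) (x : Fin n → ℂ) :
    normSqVec (P *ᵥ x) ≤ c ^ 2 * normSqVec x := by
  have key : ∀ u v : Fin n → ℂ, 2 * ‖star u ⬝ᵥ P *ᵥ star v‖ ≤ c * (normSqVec u + normSqVec v) := by
    intro u v
    have hsymm : star v ⬝ᵥ P *ᵥ star u = star u ⬝ᵥ P *ᵥ star v := by
      rw [Matrix.dotProduct_mulVec, ← Matrix.mulVec_transpose, hP, dotProduct_comm]
    -- Polarization: symmetry of `P` makes (u, v) ↦ uᴴPv̄ symmetric, so it is recovered from its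
    -- values on u ± v.
    have h1 : 4 * (star u ⬝ᵥ P *ᵥ star v) = star (u + v) ⬝ᵥ P *ᵥ star (u + v)
        - star (u - v) ⬝ᵥ P *ᵥ star (u - v) := by
      simp only [star_add, star_sub, Matrix.mulVec_add, Matrix.mulVec_sub, add_dotProduct,
        sub_dotProduct, dotProduct_add, dotProduct_sub, hsymm]
      ring
    have h2 : normSqVec (u + v) + normSqVec (u - v) = 2 * (normSqVec u + normSqVec v) := by
      simp only [normSqVec_eq_norm_sq, WithLp.toLp_add, WithLp.toLp_sub]
      have := parallelogram_law_with_norm ℂ (WithLp.toLp 2 u) (WithLp.toLp 2 v)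
      nlinarith
    have h3 : 4 * ‖star u ⬝ᵥ P *ᵥ star v‖ ≤ c * normSqVec (u + v) + c * normSqVec (u - v) := by
      calc 4 * ‖star u ⬝ᵥ P *ᵥ star v‖ = ‖4 * (star u ⬝ᵥ P *ᵥ star v)‖ := by simp
        _ ≤ _ := by rw [h1]; exact (norm_sub_le _ _).trans (add_le_add (h _) (h _))
    rw [← mul_add, h2] at h3
    linarith
  set w := P *ᵥ x with hw
  have hW := normSqVec_nonneg w
  have hX := normSqVec_nonneg x
  -- Test the polarized bound on the pair (t·Px, x̄). The weight t is free, and t = 1/c balances the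
  -- two terms below; c = 0 is treated separately with t = 1.
  have key2 : ∀ t : ℝ, 0 ≤ t → 2 * (t * normSqVec w) ≤ c * (t ^ 2 * normSqVec w + normSqVec x) := by
    intro t ht
    have h4 := key ((t : ℂ) • w) (star x)
    rw [star_star, ← hw, star_smul, smul_dotProduct, star_dotProduct_self, normSqVec_star,
      normSqVec_smul] at h4
    simpa [abs_of_nonneg ht, abs_of_nonneg hW] using h4
  rcases hc.eq_or_lt with h0 | h0
  · have := key2 1 zero_le_one
    rw [← h0] at this ⊢
    nlinarith
  · have := key2 (1 / c) (by positivity)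
    have h5 : c * ((1 / c) ^ 2 * normSqVec w + normSqVec x)
      = normSqVec w / c + c * normSqVec x := by field_simp
    rw [h5] at this
    have h6 : normSqVec w / c ≤ c * normSqVec x := by
      have : 2 * (1 / c * normSqVec w) = 2 * (normSqVec w / c) := by ring
      linarith
    rw [div_le_iff₀ h0] at h6
    nlinarith

theorem charpoly_toEuclideanLin (A : Matrix (Fin n) (Fin n) ℂ) :
    (Matrix.toEuclideanLin A).charpoly = A.charpoly := by
  rw [Matrix.toEuclideanLin, Matrix.toLpLin_eq_toLin, ← LinearMap.charpoly_toMatrix _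
    (PiLp.basisFun 2 ℂ (Fin n)), LinearMap.toMatrix_toLin]

theorem adjoint_comp_toEuclideanLin (A : Matrix (Fin n) (Fin n) ℂ) :
    LinearMap.adjoint (Matrix.toEuclideanLin A) ∘ₗ Matrix.toEuclideanLin A
      = Matrix.toEuclideanLin (Aᴴ * A) := by
  rw [← Matrix.toEuclideanLin_conjTranspose_eq_adjoint]
  exact (Matrix.toLpLin_mul_same 2 _ _).symm

/-- The squared singular values are the eigenvalues of AᴴA with multiplicity; evaluate its
characteristic polynomial at 1. -/
theorem prod_one_sub_singVal_sq (A : Matrix (Fin n) (Fin n) ℂ) :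
    ((∏ i, (1 - singVal A i ^ 2) : ℝ) : ℂ) = (1 - Aᴴ * A).det := by
  have hn : Module.finrank ℂ (EuclideanSpace ℂ (Fin n)) = n := by simp
  have h1 := (Matrix.toEuclideanLin A).isSymmetric_adjoint_comp_self.charpoly_eq hn
  have h0 := congrArg LinearMap.charpoly (adjoint_comp_toEuclideanLin A)
  rw [charpoly_toEuclideanLin] at h0
  replace h1 := h0.symm.trans h1
  have h2 := congrArg (Polynomial.eval 1) h1
  rw [Matrix.eval_charpoly, Polynomial.eval_prod, map_one] at h2
  rw [h2, Complex.ofReal_prod]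
  refine Finset.prod_congr rfl fun i _ => ?_
  rw [singVal, LinearMap.sq_singularValues_fin _ hn i]
  simp

/-- An eigenvector v of AᴴA for the eigenvalue σᵢ² satisfies ‖Av‖² = σᵢ²‖v‖². -/
theorem singVal_sq_le {A : Matrix (Fin n) (Fin n) ℂ} {k : ℝ}
    (h : ∀ u, normSqVec (A *ᵥ u) ≤ k * normSqVec u) (i : Fin n) : singVal A i ^ 2 ≤ k := by
  have hn : Module.finrank ℂ (EuclideanSpace ℂ (Fin n)) = n := by simp
  obtain ⟨v, hv⟩ := ((Matrix.toEuclideanLin A).hasEigenvalue_adjoint_comp_self_sq_singularValues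
    (n := i) (by rw [hn]; exact i.2)).exists_hasEigenvector
  have h1 := hv.apply_eq_smul
  have h2 : ‖Matrix.toEuclideanLin A v‖ ^ 2 = singVal A i ^ 2 * ‖v‖ ^ 2 := by
    have h3 : inner ℂ v ((LinearMap.adjoint (Matrix.toEuclideanLin A) ∘ₗ
      Matrix.toEuclideanLin A) v)
      = inner ℂ (Matrix.toEuclideanLin A v) (Matrix.toEuclideanLin A v) := by
      rw [LinearMap.comp_apply, LinearMap.adjoint_inner_right]
    rw [h1, inner_smul_right, inner_self_eq_norm_sq_to_K, inner_self_eq_norm_sq_to_K] at h3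
    have := congrArg Complex.re h3
    norm_cast at this
    exact this.symm
  have h4 := h v.ofLp
  rw [normSqVec_eq_norm_sq, normSqVec_eq_norm_sq] at h4
  have h5 : 0 < ‖v‖ ^ 2 := by have := hv.2; positivity
  have h6 : ‖Matrix.toEuclideanLin A v‖ ^ 2 ≤ k * ‖v‖ ^ 2 := h4
  rw [h2] at h6
  exact le_of_mul_le_mul_right h6 h5

end Norms

/-! ### Real covariance versus complex covariance and complementary covariance -/

section Augmented

variable {m : Type*}

/-- Covariance matrix of `x + i y` in terms of the covariance matrix of `(x, y)`. -/
def complexCov (S : Matrix (m ⊕ m) (m ⊕ m) ℝ) : Matrix m m ℂ := Matrix.of fun i j =>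
  ((S (.inl i) (.inl j) + S (.inr i) (.inr j) : ℝ) : ℂ)
    + ((S (.inr i) (.inl j) - S (.inl i) (.inr j) : ℝ) : ℂ) * Complex.I

/-- Complementary covariance matrix of `x + i y` in terms of the covariance matrix of `(x, y)`. -/
def complexCompCov (S : Matrix (m ⊕ m) (m ⊕ m) ℝ) : Matrix m m ℂ := Matrix.of fun i j =>
  ((S (.inl i) (.inl j) - S (.inr i) (.inr j) : ℝ) : ℂ)
    + ((S (.inr i) (.inl j) + S (.inl i) (.inr j) : ℝ) : ℂ) * Complex.I

theorem complexCov_add (S S' : Matrix (m ⊕ m) (m ⊕ m) ℝ) :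
    complexCov (S + S') = complexCov S + complexCov S' := by
  ext i j; simp [complexCov]; ring

theorem complexCompCov_add (S S' : Matrix (m ⊕ m) (m ⊕ m) ℝ) :
    complexCompCov (S + S') = complexCompCov S + complexCompCov S' := by
  ext i j; simp [complexCompCov]; ring

theorem complexCompCov_transpose {S : Matrix (m ⊕ m) (m ⊕ m) ℝ} (hS : Sᵀ = S) :
    (complexCompCov S)ᵀ = complexCompCov S := by
  have h : ∀ a b, S a b = S b a := fun a b => congrFun₂ hS b a
  ext i j
  simp only [complexCompCov, Matrix.transpose_apply, Matrix.of_apply]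
  rw [h (.inl i) (.inl j), h (.inr i) (.inr j), h (.inr i) (.inl j), h (.inl i) (.inr j),
    add_comm (S (.inl j) (.inr i))]

/-- The real symmetric matrix with given complex covariance and complementary covariance. -/
noncomputable def realCov (C P : Matrix m m ℂ) : Matrix (m ⊕ m) (m ⊕ m) ℝ := Matrix.fromBlocks
  (Matrix.of fun i j => ((C i j).re + (P i j).re) / 2)
  (Matrix.of fun i j => ((P i j).im - (C i j).im) / 2)
  (Matrix.of fun i j => ((C i j).im + (P i j).im) / 2)
  (Matrix.of fun i j => ((C i j).re - (P i j).re) / 2)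

theorem complexCov_realCov (C P : Matrix m m ℂ) : complexCov (realCov C P) = C := by
  ext i j
  simp only [complexCov, realCov, Matrix.of_apply, Matrix.fromBlocks_apply₁₁,
    Matrix.fromBlocks_apply₁₂, Matrix.fromBlocks_apply₂₁, Matrix.fromBlocks_apply₂₂]
  apply Complex.ext <;> simp <;> ring

theorem complexCompCov_realCov (C P : Matrix m m ℂ) : complexCompCov (realCov C P) = P := by
  ext i j
  simp only [complexCompCov, realCov, Matrix.of_apply, Matrix.fromBlocks_apply₁₁,
    Matrix.fromBlocks_apply₁₂, Matrix.fromBlocks_apply₂₁, Matrix.fromBlocks_apply₂₂]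
  apply Complex.ext <;> simp <;> ring

theorem realCov_transpose {C P : Matrix m m ℂ} (hC : Cᴴ = C) (hP : Pᵀ = P) :
    (realCov C P)ᵀ = realCov C P := by
  have h1 : ∀ i j, star (C j i) = C i j := fun i j => congrFun₂ hC i j
  have h2 : ∀ i j, P j i = P i j := fun i j => congrFun₂ hP i j
  have hr : ∀ i j, (C j i).re = (C i j).re := fun i j => by rw [← h1 i j]; simp
  have hi : ∀ i j, (C j i).im = -(C i j).im := fun i j => by rw [← h1 i j]; simp
  ext (i | i) (j | j) <;> simp [realCov, h2 i j, hr i j, hi i j] <;> ring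

variable [Fintype m]

/-- Real and imaginary parts of a complex vector. -/
def realVec (u : m → ℂ) : m ⊕ m → ℝ := Sum.elim (fun i => (u i).re) (fun i => (u i).im)

/-- The bridge between the two pictures: every definiteness statement about real 2n × 2n covariance
matrices is read off from this identity. -/
theorem quadForm_realVec (S : Matrix (m ⊕ m) (m ⊕ m) ℝ) (u : m → ℂ) :
    realVec u ⬝ᵥ S *ᵥ realVec u
      = (star u ⬝ᵥ complexCov S *ᵥ u + star u ⬝ᵥ complexCompCov S *ᵥ star u).re / 2 := by
  have hL : realVec u ⬝ᵥ S *ᵥ realVec u = ∑ i, ∑ j,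
      ((u i).re * (S (.inl i) (.inl j) * (u j).re) + (u i).re * (S (.inl i) (.inr j) * (u j).im)
      + ((u i).im * (S (.inr i) (.inl j) * (u j).re)
      + (u i).im * (S (.inr i) (.inr j) * (u j).im))) := by
    simp only [dotProduct, Matrix.mulVec, Fintype.sum_sum_type, realVec, Sum.elim_inl,
      Sum.elim_inr, Finset.mul_sum, mul_add, Finset.sum_add_distrib]
    ring
  have hR : star u ⬝ᵥ complexCov S *ᵥ u + star u ⬝ᵥ complexCompCov S *ᵥ star u = ∑ i, ∑ j,
      (star (u i) * (complexCov S i j * u j)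
        + star (u i) * (complexCompCov S i j * star (u j))) := by
    simp only [dotProduct, Matrix.mulVec, Finset.mul_sum, Finset.sum_add_distrib, Pi.star_apply]
  rw [hL, hR, Complex.re_sum, Finset.sum_div]
  refine Finset.sum_congr rfl fun i _ => ?_
  rw [Complex.re_sum, Finset.sum_div]
  refine Finset.sum_congr rfl fun j _ => ?_
  simp [complexCov, complexCompCov]
  ring

variable [DecidableEq m]

/-- The matrix of `(x, y) ↦ (x + i y, x - i y)`. -/
def augMatrix (m : Type*) [DecidableEq m] : Matrix (m ⊕ m) (m ⊕ m) ℂ :=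
  Matrix.fromBlocks 1 (Complex.I • 1) 1 (-Complex.I • 1)

/-- Congruence by the augmentation map turns the covariance of (x, y) into that of (v, v̄), v = x +
iy, whose blocks are C, P and their conjugates. -/
theorem augMatrix_mul (S : Matrix (m ⊕ m) (m ⊕ m) ℝ) :
    augMatrix m * S.map Complex.ofReal * (augMatrix m)ᴴ
      = Matrix.fromBlocks (complexCov S) (complexCompCov S)
        ((complexCompCov S).map star) ((complexCov S).map star) := by
  ext (i | i) (j | j) <;>
    simp [augMatrix, Matrix.mul_apply, Fintype.sum_sum_type, Matrix.one_apply,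
      Matrix.conjTranspose_apply, complexCov, complexCompCov]
  all_goals
    simp only [apply_ite (starRingEnd ℂ), Complex.conj_I, map_zero, mul_ite, mul_zero,
      Finset.sum_ite_eq, Finset.mem_univ, if_true]
    ring_nf
    simp only [Complex.I_sq]
    ring

/-- Determinant of the real covariance matrix of a vector with scalar covariance matrix. -/
theorem det_eq_of_complexCov_eq_smul {n : ℕ} {S : Matrix (Fin n ⊕ Fin n) (Fin n ⊕ Fin n) ℝ}
    (hS : Sᵀ = S) {s : ℝ} (hs : 0 < s) (hC : complexCov S = ((2 * s : ℝ) : ℂ) • 1) :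
    S.det = s ^ (n + n) *
      ∏ i, (1 - singVal (((1 / (2 * s) : ℝ) : ℂ) • complexCompCov S) i ^ 2) := by
  set M := ((1 / (2 * s) : ℝ) : ℂ) • complexCompCov S with hM
  have hP : complexCompCov S = ((2 * s : ℝ) : ℂ) • M := by
    rw [hM, smul_smul, ← Complex.ofReal_mul, mul_one_div_cancel (by positivity),
      Complex.ofReal_one, one_smul]
  -- Symmetry of the complementary covariance turns the conjugate block into Mᴴ, so the Schur
  -- complement below is 1 − MᴴM.
  have hMM : M.map star = Mᴴ := by
    have : Mᵀ = M := by rw [hM, Matrix.transpose_smul, complexCompCov_transpose hS]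
    rw [Matrix.conjTranspose, this]
  have h1 := congrArg Matrix.det (augMatrix_mul S)
  -- The case S = 1 yields the product of the determinants of the augmentation matrix and its
  -- adjoint, namely 2²ⁿ, without expanding either.
  have h2 := congrArg Matrix.det (augMatrix_mul (1 : Matrix (Fin n ⊕ Fin n) (Fin n ⊕ Fin n) ℝ))
  have hdet : ∀ R : Matrix (Fin n ⊕ Fin n) (Fin n ⊕ Fin n) ℝ,
      (R.map Complex.ofReal).det = (R.det : ℂ) := fun R => (Complex.ofRealHom.map_det R).symm
  have hconj : (starRingEnd ℂ) 2 = 2 := Complex.conj_ofReal 2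
  have hC1 : complexCov (1 : Matrix (Fin n ⊕ Fin n) (Fin n ⊕ Fin n) ℝ) = (2 : ℂ) • 1 := by
    ext i j
    by_cases hij : i = j <;> simp [complexCov, hij, Matrix.one_apply]
    norm_num
  have hP1 : complexCompCov (1 : Matrix (Fin n ⊕ Fin n) (Fin n ⊕ Fin n) ℝ) = 0 := by
    ext i j
    by_cases hij : i = j <;> simp [complexCompCov, hij, Matrix.one_apply]
  have hb1 : Matrix.fromBlocks ((2 : ℂ) • (1 : Matrix (Fin n) (Fin n) ℂ)) 0
      ((0 : Matrix (Fin n) (Fin n) ℂ).map star) (((2 : ℂ) • (1 : Matrix (Fin n) (Fin n) ℂ)).map star)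
      = (2 : ℂ) • (1 : Matrix (Fin n ⊕ Fin n) (Fin n ⊕ Fin n) ℂ) := by
    rw [← Matrix.fromBlocks_one, Matrix.fromBlocks_smul]
    congr 1
    · simp
    · ext i j; simp
    · ext i j
      by_cases hij : i = j <;> simp [hij, hconj]
  have hb : Matrix.fromBlocks (complexCov S) (complexCompCov S)
        ((complexCompCov S).map star) ((complexCov S).map star)
      = ((2 * s : ℝ) : ℂ) • Matrix.fromBlocks 1 M Mᴴ 1 := by
    rw [hC, hP, Matrix.fromBlocks_smul, ← hMM]
    congr 1
    · ext i j; simp [hconj]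
    · ext i j
      by_cases hij : i = j <;> simp [hij, hconj]
  rw [hC1, hP1, hb1, Matrix.det_mul, Matrix.det_mul, hdet, Matrix.det_one, Matrix.det_smul,
    Matrix.det_one] at h2
  rw [hb, Matrix.det_mul, Matrix.det_mul, hdet, Matrix.det_smul, Matrix.det_fromBlocks_one₁₁,
    ← prod_one_sub_singVal_sq] at h1
  simp only [Fintype.card_sum, Fintype.card_fin, Complex.ofReal_one, mul_one] at h1 h2
  have h3 : ((augMatrix (Fin n)).det * (augMatrix (Fin n))ᴴ.det) * (S.det : ℂ)
      = ((2 * s : ℝ) : ℂ) ^ (n + n) * ((∏ i, (1 - singVal M i ^ 2) : ℝ) : ℂ) := by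
    rw [← h1]; ring
  rw [h2] at h3
  have h4 : (2 : ℝ) ^ (n + n) * S.det = (2 * s) ^ (n + n) * ∏ i, (1 - singVal M i ^ 2) := by
    exact_mod_cast h3
  rw [mul_pow, mul_assoc] at h4
  exact mul_left_cancel₀ (by positivity) h4

end Augmented

/-! ### Real coordinates of complex vectors -/

section Coordinates

variable {n : ℕ}

/-- The complex vector with given real and imaginary parts. -/
noncomputable def complexVec (v : Fin n ⊕ Fin n → ℝ) : Fin n → ℂ :=
  fun i => (v (.inl i) : ℂ) + (v (.inr i) : ℂ) * Complex.I

theorem complexVec_realVec (u : Fin n → ℂ) : complexVec (realVec u) = u := by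
  ext i; simp [complexVec, realVec, Complex.re_add_im]

theorem realVec_complexVec (v : Fin n ⊕ Fin n → ℝ) : realVec (complexVec v) = v := by
  ext (i | i) <;> simp [complexVec, realVec]

theorem realVec_add (u v : Fin n → ℂ) : realVec (u + v) = realVec u + realVec v := by
  ext (i | i) <;> simp [realVec]

theorem sum_realVec_sq (u : Fin n → ℂ) : ∑ a, realVec u a ^ 2 = normSqVec u := by
  rw [Fintype.sum_sum_type, ← Finset.sum_add_distrib, normSqVec]
  refine Finset.sum_congr rfl fun i _ => ?_
  simp only [realVec, Sum.elim_inl, Sum.elim_inr]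
  rw [Complex.sq_norm, Complex.normSq_apply, sq, sq]

/-- Real coordinates of `H⁻¹ y`. -/
noncomputable def coordLinearEquiv (H : Matrix (Fin n) (Fin n) ℂ) (hH : IsUnit H.det) :
    (Fin n → ℂ) ≃ₗ[ℝ] (Fin n ⊕ Fin n → ℝ) where
  toFun y := realVec (H⁻¹ *ᵥ y)
  invFun v := H *ᵥ complexVec v
  map_add' x y := by rw [Matrix.mulVec_add, realVec_add]
  map_smul' c x := by
    rw [Matrix.mulVec_smul]
    ext (i | i) <;> simp [realVec]
  left_inv y := by
    simp only [complexVec_realVec, Matrix.mulVec_mulVec, Matrix.mul_nonsing_inv _ hH,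
      Matrix.one_mulVec]
  right_inv v := by
    simp only [Matrix.mulVec_mulVec, Matrix.nonsing_inv_mul _ hH, Matrix.one_mulVec,
      realVec_complexVec]

/-- Real coordinates of `H⁻¹ y`. -/
noncomputable def coordCLE (H : Matrix (Fin n) (Fin n) ℂ) (hH : IsUnit H.det) :
    (Fin n → ℂ) ≃L[ℝ] (Fin n ⊕ Fin n → ℝ) := (coordLinearEquiv H hH).toContinuousLinearEquiv

theorem coordCLE_apply (H : Matrix (Fin n) (Fin n) ℂ) (hH : IsUnit H.det) (y : Fin n → ℂ) :
    coordCLE H hH y = realVec (H⁻¹ *ᵥ y) := rfl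

theorem coordCLE_one_apply (y : Fin n → ℂ) :
    coordCLE (1 : Matrix (Fin n) (Fin n) ℂ) (by simp) y = realVec y := by
  rw [coordCLE_apply, inv_one, Matrix.one_mulVec]

theorem continuous_realVec : Continuous (realVec : (Fin n → ℂ) → Fin n ⊕ Fin n → ℝ) := by
  refine continuous_pi fun a => ?_
  rcases a with i | i
  · exact Complex.continuous_re.comp (continuous_apply i)
  · exact Complex.continuous_im.comp (continuous_apply i)

theorem measurable_realVec_apply (a : Fin n ⊕ Fin n) :
    Measurable fun u : Fin n → ℂ => realVec u a :=
  ((continuous_apply a).comp continuous_realVec).measurable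

end Coordinates

/-! ### Second moments of complex random vectors -/

section Moments

variable {n : ℕ} {Ω : Type*} [MeasurableSpace Ω]

/-- Matrix of the second moments of the real and imaginary parts of a complex random vector. -/
noncomputable def secondMoment (μ : Measure Ω) (X : Ω → Fin n → ℂ) :
    Matrix (Fin n ⊕ Fin n) (Fin n ⊕ Fin n) ℝ :=
  Matrix.of fun a b => ∫ ω, realVec (X ω) a * realVec (X ω) b ∂μ

variable {μ : Measure Ω} {X : Ω → Fin n → ℂ}

theorem secondMoment_transpose : (secondMoment μ X)ᵀ = secondMoment μ X := by
  ext a b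
  simp [secondMoment, mul_comm]

theorem trace_complexCov (S : Matrix (Fin n ⊕ Fin n) (Fin n ⊕ Fin n) ℝ) :
    (complexCov S).trace.re = S.trace := by
  simp [Matrix.trace, complexCov, Fintype.sum_sum_type, Finset.sum_add_distrib]

theorem trace_secondMoment (hX : ∀ a, MemLp (fun ω => realVec (X ω) a) 2 μ) :
    (secondMoment μ X).trace = ∫ ω, normSqVec (X ω) ∂μ := by
  simp_rw [← sum_realVec_sq]
  rw [integral_finsetSum _ fun a _ => (hX a).integrable_sq]
  simp [Matrix.trace, secondMoment, sq]

theorem integrable_normSqVec (hX : ∀ a, MemLp (fun ω => realVec (X ω) a) 2 μ) :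
    Integrable (fun ω => normSqVec (X ω)) μ := by
  simp_rw [← sum_realVec_sq]
  exact integrable_finsetSum _ fun a _ => (hX a).integrable_sq

theorem memLp_realVec_of_integrable
    (hm : ∀ a, AEStronglyMeasurable (fun ω => realVec (X ω) a) μ)
    (hX : Integrable (fun ω => normSqVec (X ω)) μ) (a : Fin n ⊕ Fin n) :
    MemLp (fun ω => realVec (X ω) a) 2 μ := by
  refine (memLp_two_iff_integrable_sq (hm a)).2 (hX.mono' ((hm a).pow 2) ?_)
  refine Filter.Eventually.of_forall fun ω => ?_
  rw [Real.norm_of_nonneg (sq_nonneg _), ← sum_realVec_sq]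
  exact Finset.single_le_sum (f := fun a => realVec (X ω) a ^ 2) (fun _ _ => sq_nonneg _)
    (Finset.mem_univ a)

theorem complexCov_secondMoment (hX : ∀ a, MemLp (fun ω => realVec (X ω) a) 2 μ) (i j : Fin n) :
    complexCov (secondMoment μ X) i j = ∫ ω, X ω i * star (X ω j) ∂μ := by
  have hi : ∀ a b, Integrable (fun ω => realVec (X ω) a * realVec (X ω) b) μ := fun a b =>
    (hX a).integrable_mul (hX b)
  have h : ∀ ω, X ω i * star (X ω j)
      = ((realVec (X ω) (.inl i) * realVec (X ω) (.inl j)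
          + realVec (X ω) (.inr i) * realVec (X ω) (.inr j) : ℝ) : ℂ)
        + ((realVec (X ω) (.inr i) * realVec (X ω) (.inl j)
          - realVec (X ω) (.inl i) * realVec (X ω) (.inr j) : ℝ) : ℂ) * Complex.I := by
    intro ω
    apply Complex.ext <;> simp [realVec] <;> ring
  simp_rw [h]
  rw [integral_add ((hi _ _).add (hi _ _)).ofReal (((hi _ _).sub (hi _ _)).ofReal.mul_const _),
    integral_mul_const, integral_complex_ofReal, integral_complex_ofReal,
    integral_add (hi _ _) (hi _ _), integral_sub (hi _ _) (hi _ _)]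
  rfl

theorem complexCompCov_secondMoment (hX : ∀ a, MemLp (fun ω => realVec (X ω) a) 2 μ)
    (i j : Fin n) :
    complexCompCov (secondMoment μ X) i j = ∫ ω, X ω i * X ω j ∂μ := by
  have hi : ∀ a b, Integrable (fun ω => realVec (X ω) a * realVec (X ω) b) μ := fun a b =>
    (hX a).integrable_mul (hX b)
  have h : ∀ ω, X ω i * X ω j
      = ((realVec (X ω) (.inl i) * realVec (X ω) (.inl j)
          - realVec (X ω) (.inr i) * realVec (X ω) (.inr j) : ℝ) : ℂ)
        + ((realVec (X ω) (.inr i) * realVec (X ω) (.inl j)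
          + realVec (X ω) (.inl i) * realVec (X ω) (.inr j) : ℝ) : ℂ) * Complex.I := by
    intro ω
    apply Complex.ext <;> simp [realVec] <;> ring
  simp_rw [h]
  rw [integral_add ((hi _ _).sub (hi _ _)).ofReal (((hi _ _).add (hi _ _)).ofReal.mul_const _),
    integral_mul_const, integral_complex_ofReal, integral_complex_ofReal,
    integral_sub (hi _ _) (hi _ _), integral_add (hi _ _) (hi _ _)]
  rfl

theorem memLp_complex_of_realVec (hX : ∀ a, MemLp (fun ω => realVec (X ω) a) 2 μ) (i : Fin n) :
    MemLp (fun ω => X ω i) 2 μ := by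
  exact memLp_re_im_iff.1 ⟨hX (.inl i), hX (.inr i)⟩

/-- Sum of independent vectors, one of them centred. -/
theorem secondMoment_prod_add {Ω' : Type*} [MeasurableSpace Ω'] {ν : Measure Ω'}
    [IsProbabilityMeasure μ] [IsProbabilityMeasure ν] {Y : Ω' → Fin n → ℂ}
    (hX : ∀ a, MemLp (fun ω => realVec (X ω) a) 2 μ)
    (hY : ∀ a, MemLp (fun ω => realVec (Y ω) a) 2 ν)
    (hY0 : ∀ a, ∫ ω, realVec (Y ω) a ∂ν = 0) :
    (∀ a, MemLp (fun p : Ω × Ω' => realVec (X p.1 + Y p.2) a) 2 (μ.prod ν)) ∧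
    secondMoment (μ.prod ν) (fun p => X p.1 + Y p.2) = secondMoment μ X + secondMoment ν Y := by
  have hX' : ∀ a, MemLp (fun p : Ω × Ω' => realVec (X p.1) a) 2 (μ.prod ν) := fun a =>
    (hX a).comp_fst ν
  have hY' : ∀ a, MemLp (fun p : Ω × Ω' => realVec (Y p.2) a) 2 (μ.prod ν) := fun a =>
    (hY a).comp_snd μ
  refine ⟨fun a => ?_, ?_⟩
  · simp only [realVec_add, Pi.add_apply]
    exact (hX' a).add (hY' a)
  ext a b
  simp only [secondMoment, Matrix.of_apply, Matrix.add_apply, realVec_add, Pi.add_apply]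
  have h : ∀ p : Ω × Ω', (realVec (X p.1) a + realVec (Y p.2) a)
      * (realVec (X p.1) b + realVec (Y p.2) b)
      = (realVec (X p.1) a * realVec (X p.1) b + realVec (Y p.2) a * realVec (Y p.2) b)
        + (realVec (X p.1) a * realVec (Y p.2) b + realVec (X p.1) b * realVec (Y p.2) a) := by
    intro p; ring
  simp_rw [h]
  have i1 : Integrable (fun p : Ω × Ω' => realVec (X p.1) a * realVec (X p.1) b)
      (μ.prod ν) := (hX' a).integrable_mul (hX' b)
  have i2 : Integrable (fun p : Ω × Ω' => realVec (Y p.2) a * realVec (Y p.2) b)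
      (μ.prod ν) := (hY' a).integrable_mul (hY' b)
  have i3 : Integrable (fun p : Ω × Ω' => realVec (X p.1) a * realVec (Y p.2) b)
      (μ.prod ν) := (hX' a).integrable_mul (hY' b)
  have i4 : Integrable (fun p : Ω × Ω' => realVec (X p.1) b * realVec (Y p.2) a)
      (μ.prod ν) := (hX' b).integrable_mul (hY' a)
  have i12 : Integrable (fun p : Ω × Ω' => realVec (X p.1) a * realVec (X p.1) b
      + realVec (Y p.2) a * realVec (Y p.2) b) (μ.prod ν) := i1.add i2
  have i34 : Integrable (fun p : Ω × Ω' => realVec (X p.1) a * realVec (Y p.2) b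
      + realVec (X p.1) b * realVec (Y p.2) a) (μ.prod ν) := i3.add i4
  rw [integral_add i12 i34, integral_add i1 i2, integral_add i3 i4]
  have e1 : ∫ p : Ω × Ω', realVec (X p.1) a * realVec (X p.1) b ∂(μ.prod ν)
      = ∫ ω, realVec (X ω) a * realVec (X ω) b ∂μ := by
    rw [integral_fun_fst (fun ω => realVec (X ω) a * realVec (X ω) b)]; simp
  have e2 : ∫ p : Ω × Ω', realVec (Y p.2) a * realVec (Y p.2) b ∂(μ.prod ν)
      = ∫ ω, realVec (Y ω) a * realVec (Y ω) b ∂ν := by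
    rw [integral_fun_snd (fun ω => realVec (Y ω) a * realVec (Y ω) b)]; simp
  have e3 : ∀ c d, ∫ p : Ω × Ω', realVec (X p.1) c * realVec (Y p.2) d ∂(μ.prod ν) = 0 := by
    intro c d
    rw [integral_prod_mul (fun ω => realVec (X ω) c) (fun ω => realVec (Y ω) d), hY0, mul_zero]
  rw [e1, e2, e3, e3, add_zero, add_zero]

end Moments

variable {n : ℕ}

/-! ### Moments of Gaussian vectors and of their images under `H⁻¹` -/

section GaussianVectors

/-- A real coordinate of `H⁻¹ x`, as a functional. -/
noncomputable def coordFunctional (H : Matrix (Fin n) (Fin n) ℂ) (hH : IsUnit H.det)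
    (a : Fin n ⊕ Fin n) : (Fin n → ℂ) →L[ℝ] ℝ :=
  (ContinuousLinearMap.proj (R := ℝ) (φ := fun _ : Fin n ⊕ Fin n => ℝ) a).comp
    (coordCLE H hH : (Fin n → ℂ) →L[ℝ] (Fin n ⊕ Fin n → ℝ))

theorem coordFunctional_apply (H : Matrix (Fin n) (Fin n) ℂ) (hH : IsUnit H.det)
    (a : Fin n ⊕ Fin n) (x : Fin n → ℂ) :
    coordFunctional H hH a x = realVec (H⁻¹ *ᵥ x) a := rfl

theorem memLp_realVec_mulVec (μ : Measure (Fin n → ℂ)) [IsGaussian μ]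
    (H : Matrix (Fin n) (Fin n) ℂ) (hH : IsUnit H.det) (a : Fin n ⊕ Fin n) :
    MemLp (fun x => realVec (H⁻¹ *ᵥ x) a) 2 μ := by
  simp_rw [← coordFunctional_apply H hH a]
  exact IsGaussian.memLp_dual μ (coordFunctional H hH a) 2 (by simp)

theorem memLp_realVec_gaussian (μ : Measure (Fin n → ℂ)) [IsGaussian μ] (a : Fin n ⊕ Fin n) :
    MemLp (fun x => realVec x a) 2 μ := by
  simpa using memLp_realVec_mulVec μ 1 (by simp) a

theorem integral_realVec_eq_zero (μ : Measure (Fin n → ℂ)) [IsGaussian μ] (h : meanVec μ = 0)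
    (a : Fin n ⊕ Fin n) : ∫ x, realVec x a ∂μ = 0 := by
  have hi : ∀ i, Integrable (fun x : Fin n → ℂ => x i) μ := fun i =>
    (memLp_complex_of_realVec (X := fun x => x) (memLp_realVec_gaussian μ) i).integrable (by simp)
  rcases a with i | i
  · have := congrArg Complex.re (congrFun h i)
    exact (integral_re (hi i)).trans this
  · have := congrArg Complex.im (congrFun h i)
    exact (integral_im (hi i)).trans this

theorem covMat_eq (μ : Measure (Fin n → ℂ)) [IsGaussian μ] (h : meanVec μ = 0) :
    covMat μ = complexCov (secondMoment μ fun x => x) := by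
  ext i j
  rw [complexCov_secondMoment (memLp_realVec_gaussian μ)]
  simp [covMat, h]

theorem compCovMat_eq (μ : Measure (Fin n → ℂ)) [IsGaussian μ] (h : meanVec μ = 0) :
    compCovMat μ = complexCompCov (secondMoment μ fun x => x) := by
  ext i j
  rw [complexCompCov_secondMoment (memLp_realVec_gaussian μ)]
  simp [compCovMat, h]

theorem integral_dual_eq_zero_of_meanVec (μ : Measure (Fin n → ℂ)) [IsGaussian μ]
    (h : meanVec μ = 0) (L : (Fin n → ℂ) →L[ℝ] ℝ) : ∫ x, L x ∂μ = 0 := by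
  let Ψ := coordCLE (1 : Matrix (Fin n) (Fin n) ℂ) (by simp)
  have hg : IsGaussian (μ.map Ψ) := inferInstance
  have h0 : ∀ a, ∫ v, v a ∂(μ.map Ψ) = 0 := by
    intro a
    have hm : Measurable fun v : Fin n ⊕ Fin n → ℝ => v a := measurable_pi_apply a
    rw [integral_map (by fun_prop) hm.aestronglyMeasurable, ← integral_realVec_eq_zero μ h a]
    exact integral_congr_ae (Filter.Eventually.of_forall fun x =>
      congrFun (coordCLE_one_apply x) a)
  have h1 := integral_dual_eq_zero (μ.map Ψ) h0 (L.comp (Ψ.symm : _ →L[ℝ] _))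
  rw [integral_map (by fun_prop) (by fun_prop)] at h1
  simpa using h1

theorem integral_realVec_mulVec (μ : Measure (Fin n → ℂ)) [IsGaussian μ] (h : meanVec μ = 0)
    (H : Matrix (Fin n) (Fin n) ℂ) (hH : IsUnit H.det) (a : Fin n ⊕ Fin n) :
    ∫ x, realVec (H⁻¹ *ᵥ x) a ∂μ = 0 := by
  simp_rw [← coordFunctional_apply H hH a]
  exact integral_dual_eq_zero_of_meanVec μ h (coordFunctional H hH a)

theorem complexCov_secondMoment_mulVec (μ : Measure (Fin n → ℂ)) [IsGaussian μ]
    (h : meanVec μ = 0) (H : Matrix (Fin n) (Fin n) ℂ) (hH : IsUnit H.det) :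
    complexCov (secondMoment μ fun x => H⁻¹ *ᵥ x) = H⁻¹ * covMat μ * (H⁻¹)ᴴ := by
  have hm := memLp_complex_of_realVec (X := fun x => x) (memLp_realVec_gaussian μ)
  have hi : ∀ k l, Integrable (fun x : Fin n → ℂ => x k * star (x l)) μ := fun k l =>
    (hm k).integrable_mul (hm l).star
  ext i j
  rw [complexCov_secondMoment (memLp_realVec_mulVec μ H hH)]
  have e : ∀ x : Fin n → ℂ, (H⁻¹ *ᵥ x) i * star ((H⁻¹ *ᵥ x) j)
      = ∑ k, ∑ l, H⁻¹ i k * star (H⁻¹ j l) * (x k * star (x l)) := by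
    intro x
    simp only [Matrix.mulVec, dotProduct, star_sum, star_mul', Finset.sum_mul_sum]
    exact Finset.sum_congr rfl fun k _ => Finset.sum_congr rfl fun l _ => by ring
  simp_rw [e]
  rw [integral_finsetSum _ fun k _ => integrable_finsetSum _ fun l _ => (hi k l).const_mul _]
  have e2 : ∀ k, ∫ x, ∑ l, H⁻¹ i k * star (H⁻¹ j l) * (x k * star (x l)) ∂μ
      = ∑ l, H⁻¹ i k * star (H⁻¹ j l) * covMat μ k l := by
    intro k
    rw [integral_finsetSum _ fun l _ => (hi k l).const_mul _]
    refine Finset.sum_congr rfl fun l _ => ?_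
    rw [integral_const_mul, covMat_eq μ h, complexCov_secondMoment (memLp_realVec_gaussian μ)]
  simp_rw [e2, Matrix.mul_apply, Matrix.conjTranspose_apply, Finset.sum_mul]
  rw [Finset.sum_comm]
  exact Finset.sum_congr rfl fun k _ => Finset.sum_congr rfl fun l _ => by ring

theorem complexCompCov_secondMoment_mulVec (μ : Measure (Fin n → ℂ)) [IsGaussian μ]
    (h : meanVec μ = 0) (H : Matrix (Fin n) (Fin n) ℂ) (hH : IsUnit H.det) :
    complexCompCov (secondMoment μ fun x => H⁻¹ *ᵥ x) = H⁻¹ * compCovMat μ * (H⁻¹)ᵀ := by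
  have hm := memLp_complex_of_realVec (X := fun x => x) (memLp_realVec_gaussian μ)
  have hi : ∀ k l, Integrable (fun x : Fin n → ℂ => x k * x l) μ := fun k l =>
    (hm k).integrable_mul (hm l)
  ext i j
  rw [complexCompCov_secondMoment (memLp_realVec_mulVec μ H hH)]
  have e : ∀ x : Fin n → ℂ, (H⁻¹ *ᵥ x) i * (H⁻¹ *ᵥ x) j
      = ∑ k, ∑ l, H⁻¹ i k * H⁻¹ j l * (x k * x l) := by
    intro x
    simp only [Matrix.mulVec, dotProduct, Finset.sum_mul_sum]
    exact Finset.sum_congr rfl fun k _ => Finset.sum_congr rfl fun l _ => by ring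
  simp_rw [e]
  rw [integral_finsetSum _ fun k _ => integrable_finsetSum _ fun l _ => (hi k l).const_mul _]
  have e2 : ∀ k, ∫ x, ∑ l, H⁻¹ i k * H⁻¹ j l * (x k * x l) ∂μ
      = ∑ l, H⁻¹ i k * H⁻¹ j l * compCovMat μ k l := by
    intro k
    rw [integral_finsetSum _ fun l _ => (hi k l).const_mul _]
    refine Finset.sum_congr rfl fun l _ => ?_
    rw [integral_const_mul, compCovMat_eq μ h,
      complexCompCov_secondMoment (memLp_realVec_gaussian μ)]
  simp_rw [e2, Matrix.mul_apply, Matrix.transpose_apply, Finset.sum_mul]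
  rw [Finset.sum_comm]
  exact Finset.sum_congr rfl fun k _ => Finset.sum_congr rfl fun l _ => by ring

end GaussianVectors

/-! ### Positive definiteness in complex terms -/

section Positivity

variable {S : Matrix (Fin n ⊕ Fin n) (Fin n ⊕ Fin n) ℝ}

theorem posDef_of_re_pos (hS : Sᵀ = S)
    (h : ∀ u : Fin n → ℂ, u ≠ 0 →
      0 < (star u ⬝ᵥ complexCov S *ᵥ u + star u ⬝ᵥ complexCompCov S *ᵥ star u).re) :
    S.PosDef := by
  refine Matrix.PosDef.of_dotProduct_mulVec_pos ?_ fun v hv => ?_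
  · rw [Matrix.IsHermitian, Matrix.conjTranspose_eq_transpose_of_trivial, hS]
  · have hu : complexVec v ≠ 0 := fun h0 => hv <| by
      rw [← realVec_complexVec v, h0]
      ext (i | i) <;> simp [realVec]
    have := quadForm_realVec S (complexVec v)
    rw [realVec_complexVec] at this
    rw [star_trivial, this]
    exact half_pos (h _ hu)

/-- With v = Bᴴu and Q the whitened complementary covariance, the form becomes ‖v‖² + Re(vᴴQv̄) ≥ (1
− ‖Q‖)‖v‖². -/
theorem posDef_of_opNorm_lt_one (hS : Sᵀ = S) {B : Matrix (Fin n) (Fin n) ℂ} (hB : IsUnit B.det)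
    (hC : complexCov S = B * Bᴴ) (hP : opNorm (B⁻¹ * complexCompCov S * (B⁻¹)ᵀ) < 1) :
    S.PosDef := by
  refine posDef_of_re_pos hS fun u hu => ?_
  set Q := B⁻¹ * complexCompCov S * (B⁻¹)ᵀ with hQ
  have hPQ : complexCompCov S = B * Q * Bᵀ := by
    have h1 : (B⁻¹)ᵀ * Bᵀ = 1 := by
      rw [← Matrix.transpose_mul, Matrix.mul_nonsing_inv _ hB, Matrix.transpose_one]
    rw [hQ]
    simp only [Matrix.mul_assoc]
    rw [h1, Matrix.mul_one, ← Matrix.mul_assoc, Matrix.mul_nonsing_inv _ hB, Matrix.one_mul]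
  set v := Bᴴ *ᵥ u with hv
  have hv0 : v ≠ 0 := by
    intro h0
    apply hu
    have hBu : IsUnit (Bᴴ).det := by rw [Matrix.det_conjTranspose]; exact hB.star
    have : (Bᴴ)⁻¹ *ᵥ (Bᴴ *ᵥ u) = 0 := by rw [← hv, h0, Matrix.mulVec_zero]
    rwa [Matrix.mulVec_mulVec, Matrix.nonsing_inv_mul _ hBu, Matrix.one_mulVec] at this
  have hsv : star v = Bᵀ *ᵥ star u := by
    rw [hv, Matrix.star_mulVec, Matrix.conjTranspose_conjTranspose, Matrix.mulVec_transpose]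
  have hsv' : star v = star u ᵥ* B := by rw [hsv, Matrix.mulVec_transpose]
  have e1 : star u ⬝ᵥ complexCov S *ᵥ u = (normSqVec v : ℂ) := by
    rw [hC, ← Matrix.mulVec_mulVec, ← hv, Matrix.dotProduct_mulVec, ← hsv', star_dotProduct_self]
  have e2 : star u ⬝ᵥ complexCompCov S *ᵥ star u = star v ⬝ᵥ Q *ᵥ star v := by
    rw [hPQ, ← Matrix.mulVec_mulVec, ← Matrix.mulVec_mulVec, ← hsv, Matrix.dotProduct_mulVec,
      ← hsv']
  have e3 : ‖star v ⬝ᵥ Q *ᵥ star v‖ ≤ opNorm Q * normSqVec (star v) :=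
    norm_star_dotProduct_mulVec_le Q (normSqVec_star v).symm
  rw [normSqVec_star] at e3
  have e4 := normSqVec_pos hv0
  rw [e1, e2, Complex.add_re, Complex.ofReal_re]
  have e5 := Complex.abs_re_le_norm (star v ⬝ᵥ Q *ᵥ star v)
  have e6 := neg_abs_le (star v ⬝ᵥ Q *ᵥ star v).re
  nlinarith

/-- Multiplying u by a phase leaves the covariance form unchanged and multiplies the complementary
form by the square of a phase. Choosing the phase that makes the latter equal to minus its modulus,
nonnegativity of the real form gives the bound. -/
theorem norm_complexCompCov_form_le (hS : S.PosSemidef) (u : Fin n → ℂ) :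
    ‖star u ⬝ᵥ complexCompCov S *ᵥ star u‖ ≤ (star u ⬝ᵥ complexCov S *ᵥ u).re := by
  have hpos : ∀ w : Fin n → ℂ,
      0 ≤ (star w ⬝ᵥ complexCov S *ᵥ w + star w ⬝ᵥ complexCompCov S *ᵥ star w).re := by
    intro w
    have h1 := hS.dotProduct_mulVec_nonneg (realVec w)
    rw [star_trivial, quadForm_realVec] at h1
    linarith
  set z := star u ⬝ᵥ complexCompCov S *ᵥ star u with hz
  set c := star u ⬝ᵥ complexCov S *ᵥ u with hc
  have hrot : ∀ t : ℂ, ‖t‖ = 1 → 0 ≤ (c + t ^ 2 * z).re := by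
    intro t ht
    have h1 := hpos (star t • u)
    have h2 : t * star t = 1 := by
      rw [RCLike.star_def, Complex.mul_conj, Complex.normSq_eq_norm_sq, ht]; simp
    have e1 : star (star t • u) ⬝ᵥ complexCov S *ᵥ (star t • u) = c := by
      rw [star_smul, star_star, Matrix.mulVec_smul, smul_dotProduct, dotProduct_smul,
        smul_eq_mul, smul_eq_mul, ← mul_assoc, h2, one_mul]
    have e2 : star (star t • u) ⬝ᵥ complexCompCov S *ᵥ star (star t • u) = t ^ 2 * z := by
      rw [star_smul, star_star, Matrix.mulVec_smul, smul_dotProduct, dotProduct_smul,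
        smul_eq_mul, smul_eq_mul, ← mul_assoc, sq]
    rwa [e1, e2] at h1
  rcases eq_or_ne z 0 with h0 | h0
  · have := hrot 1 (by simp)
    simpa [h0] using this
  · obtain ⟨t, ht⟩ := IsAlgClosed.exists_pow_nat_eq (-((‖z‖ : ℂ) / z)) (n := 2) (by norm_num)
    have hzn : (‖z‖ : ℂ) ≠ 0 := by simpa using h0
    have ht1 : ‖t‖ = 1 := by
      have : ‖t‖ ^ 2 = 1 := by
        rw [← norm_pow, ht, norm_neg, norm_div, Complex.norm_real, norm_norm,
          div_self (norm_ne_zero_iff.2 h0)]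
      exact (pow_eq_one_iff_of_nonneg (norm_nonneg _) (by norm_num)).1 this
    have h1 := hrot t ht1
    rw [ht, neg_mul, div_mul_cancel₀ _ h0, Complex.add_re, Complex.neg_re,
      Complex.ofReal_re] at h1
    linarith

end Positivity

/-! ### Existence, densities and admissibility of Gaussian inputs -/

section GaussianLaws

theorem integral_coord_map (μ : Measure (Fin n → ℂ)) (H : Matrix (Fin n) (Fin n) ℂ)
    (hH : IsUnit H.det) (a : Fin n ⊕ Fin n) :
    ∫ v, v a ∂(μ.map (coordCLE H hH)) = ∫ x, realVec (H⁻¹ *ᵥ x) a ∂μ := by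
  have hm : Measurable fun v : Fin n ⊕ Fin n → ℝ => v a := measurable_pi_apply a
  rw [integral_map (by fun_prop) hm.aestronglyMeasurable]
  rfl

theorem integral_coord_mul_map (μ : Measure (Fin n → ℂ)) (H : Matrix (Fin n) (Fin n) ℂ)
    (hH : IsUnit H.det) (a b : Fin n ⊕ Fin n) :
    ∫ v, v a * v b ∂(μ.map (coordCLE H hH)) = secondMoment μ (fun x => H⁻¹ *ᵥ x) a b := by
  have hm : Measurable fun v : Fin n ⊕ Fin n → ℝ => v a * v b :=
    (measurable_pi_apply a).mul (measurable_pi_apply b)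
  rw [integral_map (by fun_prop) hm.aestronglyMeasurable]
  rfl

theorem exists_eq_map_gaussOf (μ : Measure (Fin n → ℂ)) [IsGaussian μ] (h : meanVec μ = 0)
    (H : Matrix (Fin n) (Fin n) ℂ) (hH : IsUnit H.det)
    (hS : (secondMoment μ fun x => H⁻¹ *ᵥ x).PosDef) :
    ∃ A : Matrix (Fin n ⊕ Fin n) (Fin n ⊕ Fin n) ℝ, A.det ≠ 0 ∧
      μ = (gaussOf A).map (coordCLE H hH).symm := by
  obtain ⟨A, -, hdet, hA⟩ := exists_eq_gaussOf (μ.map (coordCLE H hH))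
    (fun a => by rw [integral_coord_map, integral_realVec_mulVec μ h H hH]) hS
    (integral_coord_mul_map μ H hH)
  refine ⟨A, hdet, ?_⟩
  rw [← hA, Measure.map_map (by fun_prop) (by fun_prop)]
  simp

theorem exists_density (H : Matrix (Fin n) (Fin n) ℂ) (hH : IsUnit H.det) :
    ∃ κ : ℝ, 0 < κ ∧ ∀ A : Matrix (Fin n ⊕ Fin n) (Fin n ⊕ Fin n) ℝ, A.det ≠ 0 →
      (gaussOf A).map (coordCLE H hH).symm = (volume : Measure (Fin n → ℂ)).withDensity
        fun y => ENNReal.ofReal (gaussDensity (coordCLE H hH) κ A y) :=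
  exists_map_gaussOf_eq_withDensity (coordCLE H hH).symm

theorem gaussian_absolutelyContinuous (μ : Measure (Fin n → ℂ)) [IsGaussian μ]
    (h : meanVec μ = 0) (hS : (secondMoment μ fun x => x).PosDef) : μ ≪ volume := by
  have h1 : IsUnit (1 : Matrix (Fin n) (Fin n) ℂ).det := by simp
  obtain ⟨A, hA, hμ⟩ := exists_eq_map_gaussOf μ h 1 h1 (by simpa using hS)
  obtain ⟨κ, -, hκ⟩ := exists_density (1 : Matrix (Fin n) (Fin n) ℂ) h1
  rw [hμ, hκ A hA]
  exact withDensity_absolutelyContinuous _ _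

theorem exists_gaussian {S : Matrix (Fin n ⊕ Fin n) (Fin n ⊕ Fin n) ℝ} (hS : S.PosDef) :
    ∃ μ : Measure (Fin n → ℂ), IsGaussian μ ∧ meanVec μ = 0 ∧ secondMoment μ (fun x => x) = S := by
  have h1 : IsUnit (1 : Matrix (Fin n) (Fin n) ℂ).det := by simp
  obtain ⟨A, hA, -⟩ := exists_mul_transpose_eq hS
  let Ψ := coordCLE (1 : Matrix (Fin n) (Fin n) ℂ) h1
  have hback : ((gaussOf A).map Ψ.symm).map Ψ = gaussOf A := by
    rw [Measure.map_map (by fun_prop) (by fun_prop)]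
    simp
  have hG : IsGaussian ((gaussOf A).map Ψ.symm) := inferInstance
  have hmean : ∀ a, ∫ x, realVec x a ∂((gaussOf A).map Ψ.symm) = 0 := by
    intro a
    have := integral_coord_map ((gaussOf A).map Ψ.symm) 1 h1 a
    rw [hback, integral_coord_gaussOf] at this
    simpa using this.symm
  refine ⟨(gaussOf A).map Ψ.symm, hG, ?_, ?_⟩
  · funext i
    have hi : Integrable (fun x : Fin n → ℂ => x i) ((gaussOf A).map Ψ.symm) :=
      (memLp_complex_of_realVec (X := fun x => x)
        (memLp_realVec_gaussian ((gaussOf A).map Ψ.symm)) i).integrable (by simp)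
    exact Complex.ext ((integral_re hi).symm.trans (hmean (.inl i)))
      ((integral_im hi).symm.trans (hmean (.inr i)))
  · ext a b
    have := integral_coord_mul_map ((gaussOf A).map Ψ.symm) 1 h1 a b
    rw [hback, integral_coord_mul_gaussOf, hA] at this
    simpa using this.symm

theorem mem_admissible_of_gaussian (μ : Measure (Fin n → ℂ)) [IsGaussian μ] (h : meanVec μ = 0)
    (hS : (secondMoment μ fun x => x).PosDef) {P : ℝ}
    (hP : (secondMoment μ fun x => x).trace ≤ P) : μ ∈ admissible n P := by
  refine ⟨inferInstance, gaussian_absolutelyContinuous μ h hS, ?_⟩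
  have hm := memLp_realVec_gaussian μ
  rw [trace_secondMoment hm] at hP
  have := ofReal_integral_eq_lintegral_ofReal (integrable_normSqVec hm)
    (Filter.Eventually.of_forall fun x => normSqVec_nonneg x)
  change ∫⁻ x, ENNReal.ofReal (normSqVec x) ∂μ ≤ _
  rw [← this]
  exact ENNReal.ofReal_le_ofReal hP

/-- The power constraint bounds the uncentred second moments, so inputs with nonzero mean need no
separate treatment. -/
theorem memLp_of_mem_admissible {ν : Measure (Fin n → ℂ)} {P : ℝ} (hP : 0 ≤ P)
    (hν : ν ∈ admissible n P) :
    (∀ a, MemLp (fun x => realVec x a) 2 ν) ∧ (secondMoment ν fun x => x).trace ≤ P := by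
  obtain ⟨-, -, h⟩ := hν
  have hm : ∀ a, AEStronglyMeasurable (fun x : Fin n → ℂ => realVec x a) ν := fun a =>
    (measurable_realVec_apply a).aestronglyMeasurable
  have hnm : AEStronglyMeasurable (fun x : Fin n → ℂ => normSqVec x) ν := by
    simp_rw [← sum_realVec_sq]
    exact (Finset.measurable_sum _ fun a _ =>
      (measurable_realVec_apply a).pow_const 2).aestronglyMeasurable
  have h0 : 0 ≤ᵐ[ν] fun x => normSqVec x := Filter.Eventually.of_forall fun x => normSqVec_nonneg x
  have h' : ∫⁻ x, ENNReal.ofReal (normSqVec x) ∂ν ≤ ENNReal.ofReal P := h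
  have hi : Integrable (fun x => normSqVec x) ν :=
    ⟨hnm, (hasFiniteIntegral_iff_ofReal h0).2 (h'.trans_lt ENNReal.ofReal_lt_top)⟩
  have hL := memLp_realVec_of_integrable hm hi
  refine ⟨hL, ?_⟩
  rw [trace_secondMoment hL, integral_eq_lintegral_of_nonneg_ae h0 hnm]
  exact ENNReal.toReal_le_of_le_ofReal hP h'

end GaussianLaws

/-! ### Information rates of the channel in the coordinates of `H⁻¹ y` -/

section Channel

variable (H : Matrix (Fin n) (Fin n) ℂ) (hH : IsUnit H.det)

theorem measurable_mulVec_complex : Measurable fun x : Fin n → ℂ => H *ᵥ x := by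
  have : Continuous fun x : Fin n → ℂ => H *ᵥ x := by fun_prop
  exact this.measurable

theorem jointLaw_eq_map_shear (ζ ν : Measure (Fin n → ℂ)) :
    jointLaw H ζ ν = (ν.prod ζ).map (shear _ (measurable_mulVec_complex H)) := rfl

theorem coordCLE_channel (p : (Fin n → ℂ) × (Fin n → ℂ)) :
    coordCLE H hH (H *ᵥ p.1 + p.2) = realVec (p.1 + H⁻¹ *ᵥ p.2) := by
  rw [coordCLE_apply, Matrix.mulVec_add, Matrix.mulVec_mulVec, Matrix.nonsing_inv_mul _ hH,
    Matrix.one_mulVec]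

/-- Law of the real coordinates of `x + H⁻¹ z`. -/
noncomputable def equivalentOutput (ζ ν : Measure (Fin n → ℂ)) :
    Measure (Fin n ⊕ Fin n → ℝ) :=
  (ν.prod ζ).map fun p => realVec (p.1 + H⁻¹ *ᵥ p.2)

theorem measurable_equivalentOutput :
    Measurable fun p : (Fin n → ℂ) × (Fin n → ℂ) => realVec (p.1 + H⁻¹ *ᵥ p.2) :=
  continuous_realVec.measurable.comp
    (measurable_fst.add ((measurable_mulVec_complex H⁻¹).comp measurable_snd))

theorem snd_jointLaw (ζ ν : Measure (Fin n → ℂ)) :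
    (jointLaw H ζ ν).snd = (equivalentOutput H ζ ν).map (coordCLE H hH).symm := by
  rw [jointLaw_eq_map_shear, Measure.snd,
    Measure.map_map measurable_snd (shear _ (measurable_mulVec_complex H)).measurable,
    equivalentOutput, Measure.map_map (by fun_prop) (measurable_equivalentOutput H)]
  congr 1
  funext p
  simp only [Function.comp_apply, ← coordCLE_channel H hH p,
    ContinuousLinearEquiv.symm_apply_apply]
  rfl

include hH in
-- A linear image of an independent Gaussian pair is Gaussian, and centred Gaussian laws are
-- determined by their second moments, which add.
theorem equivalentOutput_eq_gaussOf (ζ ν : Measure (Fin n → ℂ)) [IsGaussian ζ] [IsGaussian ν]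
    (hζ : meanVec ζ = 0) (hν : meanVec ν = 0)
    (A : Matrix (Fin n ⊕ Fin n) (Fin n ⊕ Fin n) ℝ)
    (hA : A * Aᵀ = secondMoment ν (fun x => x) + secondMoment ζ fun x => H⁻¹ *ᵥ x) :
    equivalentOutput H ζ ν = gaussOf A := by
  have h1 : IsUnit (1 : Matrix (Fin n) (Fin n) ℂ).det := by simp
  let L : (Fin n → ℂ) × (Fin n → ℂ) →L[ℝ] (Fin n ⊕ Fin n → ℝ) :=
    ((coordCLE 1 h1 : (Fin n → ℂ) →L[ℝ] (Fin n ⊕ Fin n → ℝ))).comp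
      (ContinuousLinearMap.fst ℝ _ _)
    + ((coordCLE H hH : (Fin n → ℂ) →L[ℝ] (Fin n ⊕ Fin n → ℝ))).comp
      (ContinuousLinearMap.snd ℝ _ _)
  have hL : ∀ p, realVec (p.1 + H⁻¹ *ᵥ p.2) = L p := by
    intro p
    rw [realVec_add, ← coordCLE_one_apply]
    rfl
  have hmap : equivalentOutput H ζ ν = (ν.prod ζ).map L := by
    rw [equivalentOutput]
    congr 1
    exact funext hL
  have hG : IsGaussian (equivalentOutput H ζ ν) := by
    rw [hmap]; exact isGaussian_map L
  obtain ⟨-, hM⟩ := secondMoment_prod_add (X := fun x : Fin n → ℂ => x)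
    (memLp_realVec_gaussian ν) (memLp_realVec_mulVec ζ H hH) (integral_realVec_mulVec ζ hζ H hH)
  refine gaussian_ext _ _ (fun a => ?_) (integral_coord_gaussOf A) fun a b => ?_
  · have hm : Measurable fun v : Fin n ⊕ Fin n → ℝ => v a := measurable_pi_apply a
    rw [equivalentOutput, integral_map (measurable_equivalentOutput H).aemeasurable
      hm.aestronglyMeasurable]
    simp only [realVec_add, Pi.add_apply]
    have i1 : Integrable (fun p : (Fin n → ℂ) × (Fin n → ℂ) => realVec p.1 a) (ν.prod ζ) :=
      ((memLp_realVec_gaussian ν a).integrable (by simp)).comp_fst ζ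
    have i2 : Integrable (fun p : (Fin n → ℂ) × (Fin n → ℂ) => realVec (H⁻¹ *ᵥ p.2) a)
        (ν.prod ζ) :=
      ((memLp_realVec_mulVec ζ H hH a).integrable (by simp)).comp_snd ν
    rw [integral_add i1 i2, integral_fun_fst (fun x : Fin n → ℂ => realVec x a),
      integral_fun_snd (fun x : Fin n → ℂ => realVec (H⁻¹ *ᵥ x) a),
      integral_realVec_eq_zero ν hν, integral_realVec_mulVec ζ hζ H hH]
    simp
  · have hm : Measurable fun v : Fin n ⊕ Fin n → ℝ => v a * v b :=
      (measurable_pi_apply a).mul (measurable_pi_apply b)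
    rw [integral_coord_mul_gaussOf, hA, ← hM, equivalentOutput,
      integral_map (measurable_equivalentOutput H).aemeasurable hm.aestronglyMeasurable]
    rfl

theorem integrable_sum_mulVec_sq {Ω : Type*} [MeasurableSpace Ω] {μ : Measure Ω}
    {v : Ω → Fin n ⊕ Fin n → ℝ} (hv : ∀ a, MemLp (fun ω => v ω a) 2 μ)
    (A : Matrix (Fin n ⊕ Fin n) (Fin n ⊕ Fin n) ℝ) :
    Integrable (fun ω => ∑ i, (A *ᵥ v ω) i ^ 2) μ := by
  refine integrable_finsetSum _ fun i _ => MemLp.integrable_sq ?_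
  simp only [Matrix.mulVec, dotProduct]
  exact memLp_finsetSum _ fun a _ => (hv a).const_mul _

/-- Whitening by A⁻¹ leaves a standard Gaussian vector in 2n real dimensions. -/
theorem integral_sum_sq_gaussOf {A : Matrix (Fin n ⊕ Fin n) (Fin n ⊕ Fin n) ℝ} (hA : A.det ≠ 0) :
    ∫ v, ∑ i, (A⁻¹ *ᵥ v) i ^ 2 ∂(gaussOf A) = 2 * n := by
  have hAu : IsUnit A.det := isUnit_iff_ne_zero.2 hA
  have hm : Measurable fun v : Fin n ⊕ Fin n → ℝ => ∑ i, (A⁻¹ *ᵥ v) i ^ 2 :=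
    Finset.measurable_sum _ fun i _ =>
      ((measurable_pi_apply i).comp (measurable_mulVec A⁻¹)).pow_const 2
  rw [gaussOf, integral_map (measurable_mulVec A).aemeasurable hm.aestronglyMeasurable]
  simp_rw [Matrix.mulVec_mulVec, Matrix.nonsing_inv_mul _ hAu, Matrix.one_mulVec]
  rw [integral_finsetSum _ fun i _ => (memLp_coord _ i).integrable_sq]
  simp_rw [sq, integral_coord_mul_stdGauss]
  simp
  ring

/-- The information rate of an input is bounded through any Gaussian output law, with equality
for the true one. -/
theorem mutualInfo_gaussian_bound (b : ℝ) (ζ : Measure (Fin n → ℂ)) [IsGaussian ζ]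
    (hζ0 : meanVec ζ = 0) {κ : ℝ} (hκ : 0 < κ)
    (hdens : ∀ A : Matrix (Fin n ⊕ Fin n) (Fin n ⊕ Fin n) ℝ, A.det ≠ 0 →
      (gaussOf A).map (coordCLE H hH).symm = (volume : Measure (Fin n → ℂ)).withDensity
        fun y => ENNReal.ofReal (gaussDensity (coordCLE H hH) κ A y))
    {Az : Matrix (Fin n ⊕ Fin n) (Fin n ⊕ Fin n) ℝ} (hAz : Az.det ≠ 0)
    (hζ : ζ = (gaussOf Az).map (coordCLE H hH).symm)
    (ν : Measure (Fin n → ℂ)) [IsProbabilityMeasure ν] (hν : ν ≪ volume)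
    (hνL : ∀ a, MemLp (fun x => realVec x a) 2 ν)
    {A : Matrix (Fin n ⊕ Fin n) (Fin n ⊕ Fin n) ℝ} (hA : A.det ≠ 0) :
    ∃ I : ℝ, mutualInfo b (jointLaw H ζ ν) = ((I / Real.log b : ℝ) : EReal) ∧
      I ≤ ∫ z, Real.log (gaussDensity (coordCLE H hH) κ Az z) ∂ζ
        - (Real.log κ - Real.log |A.det|
          + Fintype.card (Fin n ⊕ Fin n) * Real.log (√(2 * Real.pi))⁻¹
          - (∫ p, ∑ i, (A⁻¹ *ᵥ realVec (p.1 + H⁻¹ *ᵥ p.2)) i ^ 2 ∂(ν.prod ζ)) / 2) ∧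
      (equivalentOutput H ζ ν = gaussOf A →
        I = ∫ z, Real.log (gaussDensity (coordCLE H hH) κ Az z) ∂ζ
          - (Real.log κ - Real.log |A.det|
            + Fintype.card (Fin n ⊕ Fin n) * Real.log (√(2 * Real.pi))⁻¹
            - (2 * n : ℝ) / 2)) := by
  set Φ := coordCLE H hH with hΦ
  have hΦm : Measurable Φ := by fun_prop
  have hq : Measurable (gaussDensity Φ κ Az) := measurable_gaussDensity hΦm κ Az
  have hg : Measurable (gaussDensity Φ κ A) := measurable_gaussDensity hΦm κ A
  have hq0 := gaussDensity_pos Φ hκ hAz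
  have hg0 := gaussDensity_pos Φ hκ hA
  -- The normalization, including the unknown `κ`, is inherited from the Gaussian law of which this
  -- is the density.
  have hg1 : ∫⁻ y, ENNReal.ofReal (gaussDensity Φ κ A y) ≤ 1 := by
    have hp : IsProbabilityMeasure ((gaussOf A).map Φ.symm) :=
      Measure.isProbabilityMeasure_map (by fun_prop)
    have := hp.measure_univ
    rw [hdens A hA, withDensity_apply _ MeasurableSet.univ, Measure.restrict_univ] at this
    exact this.le
  have hζd : ζ = (volume : Measure (Fin n → ℂ)).withDensity
      fun y => ENNReal.ofReal (gaussDensity Φ κ Az y) := hζ.trans (hdens Az hAz)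
  have hv : ∀ a, MemLp (fun p : (Fin n → ℂ) × (Fin n → ℂ) => realVec (p.1 + H⁻¹ *ᵥ p.2) a) 2
      (ν.prod ζ) :=
    (secondMoment_prod_add (X := fun x : Fin n → ℂ => x) hνL (memLp_realVec_mulVec ζ H hH)
      (integral_realVec_mulVec ζ hζ0 H hH)).1
  have hJ := integrable_sum_mulVec_sq hv A⁻¹
  have hlogg : ∀ p : (Fin n → ℂ) × (Fin n → ℂ),
      Real.log (gaussDensity Φ κ A (H *ᵥ p.1 + p.2)) = (Real.log κ - Real.log |A.det|
          + Fintype.card (Fin n ⊕ Fin n) * Real.log (√(2 * Real.pi))⁻¹)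
          - (∑ i, (A⁻¹ *ᵥ realVec (p.1 + H⁻¹ *ᵥ p.2)) i ^ 2) / 2 := fun p => by
    rw [log_gaussDensity Φ hκ hA, hΦ, coordCLE_channel H hH p]
  have hgi : Integrable (fun p : (Fin n → ℂ) × (Fin n → ℂ) =>
      Real.log (gaussDensity Φ κ A (H *ᵥ p.1 + p.2))) (ν.prod ζ) := by
    simp_rw [hlogg]
    exact (integrable_const _).sub (hJ.div_const 2)
  have hqi : Integrable (fun z => Real.log (gaussDensity Φ κ Az z)) ζ := by
    simp_rw [log_gaussDensity Φ hκ hAz]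
    exact (integrable_const _).sub ((integrable_sum_mulVec_sq
      (v := fun z => Φ z) (memLp_realVec_mulVec ζ H hH) Az⁻¹).div_const 2)
  have hqi' : Integrable (fun p : (Fin n → ℂ) × (Fin n → ℂ) =>
      Real.log (gaussDensity Φ κ Az p.2)) (ν.prod ζ) := hqi.comp_snd ν
  have hval : ∫ p, (Real.log (gaussDensity Φ κ Az p.2)
      - Real.log (gaussDensity Φ κ A (H *ᵥ p.1 + p.2))) ∂(ν.prod ζ)
      = ∫ z, Real.log (gaussDensity Φ κ Az z) ∂ζ
        - (Real.log κ - Real.log |A.det|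
          + Fintype.card (Fin n ⊕ Fin n) * Real.log (√(2 * Real.pi))⁻¹
          - (∫ p, ∑ i, (A⁻¹ *ᵥ realVec (p.1 + H⁻¹ *ᵥ p.2)) i ^ 2 ∂(ν.prod ζ)) / 2) := by
    rw [integral_sub hqi' hgi, integral_fun_snd (fun z => Real.log (gaussDensity Φ κ Az z))]
    simp_rw [hlogg]
    rw [integral_sub (integrable_const _) (hJ.div_const 2), integral_div]
    simp
  obtain ⟨hLi, hle, heq⟩ := integral_logRatio_additive_le (measurable_mulVec_complex H) hq hq0
    ν hν ζ hζd hg hg0 hg1 (hqi'.sub hgi)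
  rw [hval] at hle heq
  rw [← jointLaw_eq_map_shear] at hLi hle heq
  have hprob : IsProbabilityMeasure (jointLaw H ζ ν) :=
    Measure.isProbabilityMeasure_map
      (shear _ (measurable_mulVec_complex H)).measurable.aemeasurable
  have hac : jointLaw H ζ ν ≪ volume := by
    rw [jointLaw_eq_map_shear,
      map_shear_eq_withDensity (measurable_mulVec_complex H) hq ν hν ζ hζd]
    exact withDensity_absolutelyContinuous _ _
  refine ⟨_, mutualInfo_eq b _ hac hLi, hle, fun hout => ?_⟩
  rw [heq (by rw [snd_jointLaw H hH, hout, hdens A hA])]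
  have hJv : ∫ p, ∑ i, (A⁻¹ *ᵥ realVec (p.1 + H⁻¹ *ᵥ p.2)) i ^ 2 ∂(ν.prod ζ) = 2 * n := by
    have hm : Measurable fun v : Fin n ⊕ Fin n → ℝ => ∑ i, (A⁻¹ *ᵥ v) i ^ 2 :=
      Finset.measurable_sum _ fun i _ =>
        ((measurable_pi_apply i).comp (measurable_mulVec A⁻¹)).pow_const 2
    rw [← integral_sum_sq_gaussOf hA, ← hout, equivalentOutput,
      integral_map (measurable_equivalentOutput H).aemeasurable hm.aestronglyMeasurable]
  rw [hJv]

end Channel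

/-! ### Definiteness of the input covariances and scalar estimates -/

theorem re_form_le_opNorm (C : Matrix (Fin n) (Fin n) ℂ) (u : Fin n → ℂ) :
    (star u ⬝ᵥ C *ᵥ u).re ≤ opNorm C * normSqVec u :=
  (Complex.re_le_norm _).trans (norm_star_dotProduct_mulVec_le C rfl)

theorem re_form_smul_one_sub (s : ℝ) (C : Matrix (Fin n) (Fin n) ℂ) (u : Fin n → ℂ) :
    (star u ⬝ᵥ ((s : ℂ) • (1 : Matrix (Fin n) (Fin n) ℂ) - C) *ᵥ u).re
      = s * normSqVec u - (star u ⬝ᵥ C *ᵥ u).re := by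
  rw [Matrix.sub_mulVec, dotProduct_sub, Matrix.smul_mulVec, Matrix.one_mulVec, dotProduct_smul,
    star_dotProduct_self, Complex.sub_re, smul_eq_mul, ← Complex.ofReal_mul, Complex.ofReal_re]

theorem complexCov_smul_one (s : ℝ) :
    complexCov (s • (1 : Matrix (Fin n ⊕ Fin n) (Fin n ⊕ Fin n) ℝ))
      = ((2 * s : ℝ) : ℂ) • (1 : Matrix (Fin n) (Fin n) ℂ) := by
  ext i j
  by_cases hij : i = j <;> simp [complexCov, hij]
  ring

theorem complexCompCov_smul_one (s : ℝ) :
    complexCompCov (s • (1 : Matrix (Fin n ⊕ Fin n) (Fin n ⊕ Fin n) ℝ))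
      = (0 : Matrix (Fin n) (Fin n) ℂ) := by
  ext i j
  by_cases hij : i = j <;> simp [complexCompCov, hij]

theorem complexCov_sub (S S' : Matrix (Fin n ⊕ Fin n) (Fin n ⊕ Fin n) ℝ) :
    complexCov (S - S') = complexCov S - complexCov S' := by
  ext i j; simp [complexCov]; ring

theorem complexCompCov_sub (S S' : Matrix (Fin n ⊕ Fin n) (Fin n ⊕ Fin n) ℝ) :
    complexCompCov (S - S') = complexCompCov S - complexCompCov S' := by
  ext i j; simp [complexCompCov]; ring

/-- The complementary covariance matrix is dominated by the covariance matrix. -/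
theorem posDef_smul_one_sub {S : Matrix (Fin n ⊕ Fin n) (Fin n ⊕ Fin n) ℝ} (hS : S.PosDef)
    (hST : Sᵀ = S) {s : ℝ} (hs : opNorm (complexCov S) < s) :
    (s • (1 : Matrix (Fin n ⊕ Fin n) (Fin n ⊕ Fin n) ℝ) - S).PosDef := by
  refine posDef_of_re_pos ?_ fun u hu => ?_
  · rw [Matrix.transpose_sub, Matrix.transpose_smul, Matrix.transpose_one, hST]
  · rw [complexCov_sub, complexCompCov_sub, complexCov_smul_one, complexCompCov_smul_one,
      Complex.add_re, re_form_smul_one_sub, zero_sub, Matrix.neg_mulVec, dotProduct_neg,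
      Complex.neg_re]
    -- The complementary form is at most the covariance form, itself at most ‖C‖‖u‖²; together they
    -- cost at most 2‖C‖‖u‖² against the available 2s‖u‖².
    have h1 := norm_complexCompCov_form_le hS.posSemidef u
    have h2 := re_form_le_opNorm (complexCov S) u
    have h3 := Complex.re_le_norm (star u ⬝ᵥ complexCompCov S *ᵥ star u)
    have h4 := normSqVec_pos hu
    nlinarith

theorem posDef_of_proper {S : Matrix (Fin n ⊕ Fin n) (Fin n ⊕ Fin n) ℝ} (hST : Sᵀ = S)
    {s : ℝ} {C : Matrix (Fin n) (Fin n) ℂ} (hs : opNorm C < s)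
    (hC : complexCov S = (s : ℂ) • (1 : Matrix (Fin n) (Fin n) ℂ) - C)
    (hP : complexCompCov S = 0) : S.PosDef := by
  refine posDef_of_re_pos hST fun u hu => ?_
  rw [hC, hP, Complex.add_re, re_form_smul_one_sub, Matrix.zero_mulVec, dotProduct_zero,
    Complex.zero_re, add_zero]
  have h2 := re_form_le_opNorm C u
  have h4 := normSqVec_pos hu
  nlinarith

/-- The constant comes from 2/√3 = (3/4)^(−1/2), the value at the excluded endpoint x² = 1/4. -/
theorem log_one_sub_sq_bounds {b x : ℝ} (hb : 1 < b) (hx : x ^ 2 < 1 / 4) :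
    0 ≤ -(1 / 2) * Real.logb b (1 - x ^ 2) ∧
      -(1 / 2) * Real.logb b (1 - x ^ 2) < Real.logb b (2 / √3) := by
  have hlb := Real.log_pos hb
  have h0 : 0 < 1 - x ^ 2 := by linarith
  constructor
  · have := Real.logb_nonpos hb h0.le (by nlinarith [sq_nonneg x])
    linarith
  · have h1 : Real.logb b (3 / 4) < Real.logb b (1 - x ^ 2) :=
      Real.logb_lt_logb hb (by norm_num) (by linarith)
    have h3 : (0 : ℝ) < √3 := by positivity
    have h2 : Real.logb b (2 / √3) = -(1 / 2) * Real.logb b (3 / 4) := by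
      have e : (3 / 4 : ℝ) = ((2 / √3) ^ 2)⁻¹ := by
        rw [div_pow, Real.sq_sqrt (by norm_num)]; norm_num
      rw [e, Real.logb_inv, Real.logb_pow]
      push_cast
      ring
    linarith

theorem sqrt_smul_one_inv_mulVec {s : ℝ} (hs : 0 < s) (v : Fin n ⊕ Fin n → ℝ) :
    ∑ i, ((√s • (1 : Matrix (Fin n ⊕ Fin n) (Fin n ⊕ Fin n) ℝ))⁻¹ *ᵥ v) i ^ 2
      = (∑ i, v i ^ 2) / s := by
  have h0 : √s ≠ 0 := (Real.sqrt_pos.2 hs).ne'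
  have : (√s • (1 : Matrix (Fin n ⊕ Fin n) (Fin n ⊕ Fin n) ℝ))⁻¹ = (√s)⁻¹ • 1 := by
    refine Matrix.inv_eq_right_inv ?_
    rw [Matrix.smul_mul, Matrix.mul_smul, Matrix.one_mul, smul_smul, mul_inv_cancel₀ h0, one_smul]
  rw [this]
  simp_rw [Matrix.smul_mulVec, Matrix.one_mulVec, Pi.smul_apply, smul_eq_mul, mul_pow, inv_pow,
    Real.sq_sqrt hs.le, ← Finset.mul_sum]
  rw [div_eq_inv_mul]

end ComplexChannel

/-! ### The capacity loss -/

open ComplexChannel in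
theorem mainTheorem11 (b : ℝ) (hb : 1 < b) (n : ℕ) (hn : 0 < n) (S : ℝ)
    (H : Matrix (Fin n) (Fin n) ℂ) (hH : IsUnit H.det)
    (ζ : Measure (Fin n → ℂ)) (hGauss : IsGaussian ζ)
    (hmean : ComplexChannel.meanVec ζ = 0)
    (hC : IsUnit (ComplexChannel.covMat ζ).det)
    (hS : 2 * (n : ℝ) * ComplexChannel.opNorm (H⁻¹ * ComplexChannel.covMat ζ * (H⁻¹)ᴴ) ≤ S)
    (B : Matrix (Fin n) (Fin n) ℂ) (hB : ComplexChannel.covMat ζ = B * Bᴴ)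
    (hP : ComplexChannel.opNorm (B⁻¹ * ComplexChannel.compCovMat ζ * (B⁻¹)ᵀ) < 1)
    (μ : Fin n → ℝ)
    (hμ : μ = ComplexChannel.singVal
      (((n / ComplexChannel.totalPower H (ComplexChannel.covMat ζ) S : ℝ) : ℂ) •
        (H⁻¹ * ComplexChannel.compCovMat ζ * (H⁻¹)ᵀ))) :
    (∃ ν : Measure (Fin n → ℂ),
      ComplexChannel.IsMismatchedInput H (ComplexChannel.covMat ζ) S ν) ∧
    ∀ ν : Measure (Fin n → ℂ),
      ComplexChannel.IsMismatchedInput H (ComplexChannel.covMat ζ) S ν →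
      ν ∈ ComplexChannel.admissible n S ∧
      ∃ C C' : ℝ,
        ComplexChannel.capacity b H ζ S = (C : EReal) ∧
        ComplexChannel.mutualInfo b (ComplexChannel.jointLaw H ζ ν) = (C' : EReal) ∧
        C - C' = -(1 / 2) * ∑ i, Real.logb b (1 - μ i ^ 2) ∧
        0 ≤ C - C' ∧
        C - C' < n * Real.logb b (2 / √3) := by
  have hn' : (0 : ℝ) < n := by exact_mod_cast hn
  have hlb : 0 < Real.log b := Real.log_pos hb
  set W := secondMoment ζ fun x => H⁻¹ *ᵥ x with hW
  have hWT : Wᵀ = W := secondMoment_transpose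
  have hWC : complexCov W = H⁻¹ * covMat ζ * (H⁻¹)ᴴ := complexCov_secondMoment_mulVec ζ hmean H hH
  have hWP : complexCompCov W = H⁻¹ * compCovMat ζ * (H⁻¹)ᵀ :=
    complexCompCov_secondMoment_mulVec ζ hmean H hH
  have hWpos : W.PosDef := by
    have hBu : IsUnit B.det := by
      rw [hB, Matrix.det_mul] at hC
      exact isUnit_of_mul_isUnit_left hC
    -- The factor H⁻¹B of the transformed covariance leaves the whitened complementary covariance
    -- B⁻¹P_zB⁻ᵀ unchanged, so the hypothesis on its norm applies to `W`.
    refine posDef_of_opNorm_lt_one (B := H⁻¹ * B) hWT ?_ ?_ ?_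
    · rw [Matrix.det_mul]
      exact (Matrix.isUnit_nonsing_inv_det _ hH).mul hBu
    · rw [hWC, hB, Matrix.conjTranspose_mul]
      simp only [Matrix.mul_assoc]
    · have h1 : (H⁻¹ * B)⁻¹ = B⁻¹ * H := by
        rw [Matrix.mul_inv_rev, Matrix.nonsing_inv_nonsing_inv _ hH]
      have h2 : (H⁻¹)ᵀ * Hᵀ = 1 := by
        rw [← Matrix.transpose_mul, Matrix.mul_nonsing_inv _ hH, Matrix.transpose_one]
      have h3 : B⁻¹ * H * (H⁻¹ * compCovMat ζ * (H⁻¹)ᵀ) * (B⁻¹ * H)ᵀ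
          = B⁻¹ * (H * H⁻¹) * compCovMat ζ * ((H⁻¹)ᵀ * Hᵀ) * (B⁻¹)ᵀ := by
        rw [Matrix.transpose_mul]
        simp only [Matrix.mul_assoc]
      rw [h1, hWP, h3, h2, Matrix.mul_nonsing_inv _ hH, Matrix.mul_one, Matrix.mul_one]
      exact hP
  rw [← hWC] at hS
  set c := opNorm (complexCov W) with hc
  have hc0 : 0 ≤ c := opNorm_nonneg _
  have hS0 : 0 ≤ S := le_trans (by positivity) hS
  have htr : 0 < W.trace := by
    have : Nonempty (Fin n) := ⟨⟨0, hn⟩⟩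
    exact hWpos.trace_pos
  have htp : totalPower H (covMat ζ) S = S + W.trace := by
    rw [totalPower, ← hWC, trace_complexCov]
  -- The variance per real coordinate when the total output power is spread evenly; the complex
  -- water level is 2s.
  set s := (S + W.trace) / (2 * n) with hs
  have h2s : (S + W.trace) / n = 2 * s := by rw [hs]; field_simp
  have hsn : 2 * n * s = S + W.trace := by rw [hs]; field_simp
  -- Strict although the power hypothesis is not, because tr W > 0.
  have hcs : c < s := by
    rw [hs, lt_div_iff₀ (by positivity)]
    linarith
  have hs0 : 0 < s := hc0.trans_lt hcs
  obtain ⟨κ, hκ, hdens⟩ := exists_density H hH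
  obtain ⟨Az, hAz, hζ⟩ := exists_eq_map_gaussOf ζ hmean H hH hWpos
  set h0 := ∫ z, Real.log (gaussDensity (coordCLE H hH) κ Az z) ∂ζ with hh0
  set k := Fintype.card (Fin n ⊕ Fin n) * Real.log (√(2 * Real.pi))⁻¹ with hk
  have hMis : ∀ ν, IsMismatchedInput H (covMat ζ) S ν ↔ IsGaussian ν ∧ meanVec ν = 0 ∧
      covMat ν = ((2 * s : ℝ) : ℂ) • (1 : Matrix (Fin n) (Fin n) ℂ) - complexCov W ∧
      compCovMat ν = 0 := fun ν => by
    rw [IsMismatchedInput, htp, h2s, hWC]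
  have hc2s : c < 2 * s := by linarith
  refine ⟨?_, fun ν hν => ?_⟩
  · set Cx := ((2 * s : ℝ) : ℂ) • (1 : Matrix (Fin n) (Fin n) ℂ) - complexCov W with hCx
    have hCxH : Cxᴴ = Cx := by
      have h1 : (complexCov W)ᴴ = complexCov W := by
        rw [hWC, hB]
        simp only [Matrix.conjTranspose_mul, Matrix.conjTranspose_conjTranspose, Matrix.mul_assoc]
      rw [hCx, Matrix.conjTranspose_sub, Matrix.conjTranspose_smul, Matrix.conjTranspose_one, h1]
      simp
    have hpd : (realCov Cx 0).PosDef :=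
      posDef_of_proper (realCov_transpose hCxH Matrix.transpose_zero) hc2s
        (complexCov_realCov Cx 0) (complexCompCov_realCov Cx 0)
    obtain ⟨ν, hG, hm, hM⟩ := exists_gaussian hpd
    refine ⟨ν, (hMis ν).2 ⟨hG, hm, ?_, ?_⟩⟩
    · rw [covMat_eq ν hm, hM, complexCov_realCov]
    · rw [compCovMat_eq ν hm, hM, complexCompCov_realCov]
  obtain ⟨hG, hm, hcov, hcomp⟩ := (hMis ν).1 hν
  rw [covMat_eq ν hm] at hcov
  rw [compCovMat_eq ν hm] at hcomp
  set X := secondMoment ν fun x => x with hX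
  have hXT : Xᵀ = X := secondMoment_transpose
  have hXpos : X.PosDef := posDef_of_proper hXT hc2s hcov hcomp
  have hXtr : X.trace = S := by
    have h1 := congrArg (fun M : Matrix (Fin n) (Fin n) ℂ => M.trace.re) hcov
    simp only [Matrix.trace_sub, Matrix.trace_smul, Matrix.trace_one, Complex.sub_re,
      trace_complexCov, Fintype.card_fin, smul_eq_mul] at h1
    rw [h1, ← Complex.ofReal_natCast, ← Complex.ofReal_mul, Complex.ofReal_re]
    linarith
  have hνadm : ν ∈ admissible n S := mem_admissible_of_gaussian ν hm hXpos hXtr.le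
  refine ⟨hνadm, ?_⟩
  -- the equivalent output of the mismatched input
  have hOpos : (X + W).PosDef := hXpos.add_posSemidef hWpos.posSemidef
  obtain ⟨A', hA', hA'0⟩ := exists_mul_transpose_eq hOpos
  obtain ⟨I', hI', -, hI'eq⟩ := mutualInfo_gaussian_bound H hH b ζ hmean hκ hdens hAz hζ ν
    hνadm.2.1 (memLp_realVec_gaussian ν) hA'0
  replace hI'eq := hI'eq (equivalentOutput_eq_gaussOf H hH ζ ν hmean hm A' hA')
  -- the optimal output
  set A₀ := √s • (1 : Matrix (Fin n ⊕ Fin n) (Fin n ⊕ Fin n) ℝ) with hA₀d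
  have hA₀ : A₀ * A₀ᵀ = s • 1 := by
    rw [hA₀d, Matrix.transpose_smul, Matrix.transpose_one, Matrix.smul_mul, Matrix.mul_smul,
      Matrix.one_mul, smul_smul, Real.mul_self_sqrt hs0.le]
  have hA₀det : A₀.det * A₀.det = s ^ (n + n) := by
    have := congrArg Matrix.det hA₀
    rw [Matrix.det_mul, Matrix.det_transpose] at this
    rw [this, Matrix.det_smul, Matrix.det_one]
    simp
  have hA₀0 : A₀.det ≠ 0 := by
    intro h
    rw [h, mul_zero] at hA₀det
    exact (pow_pos hs0 _).ne hA₀det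
  set cap := h0 - (Real.log κ - Real.log |A₀.det| + k - (2 * n : ℝ) / 2) with hcap
  have hupper : ∀ ν' ∈ admissible n S,
      mutualInfo b (jointLaw H ζ ν') ≤ ((cap / Real.log b : ℝ) : EReal) := by
    intro ν' hν'
    have hprob : IsProbabilityMeasure ν' := hν'.1
    obtain ⟨hL, htrace⟩ := memLp_of_mem_admissible hS0 hν'
    obtain ⟨I, hI, hIle, -⟩ := mutualInfo_gaussian_bound H hH b ζ hmean hκ hdens hAz hζ ν'
      hν'.2.1 hL hA₀0
    obtain ⟨hvL, hvM⟩ := secondMoment_prod_add (X := fun x : Fin n → ℂ => x) hL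
      (memLp_realVec_mulVec ζ H hH) (integral_realVec_mulVec ζ hmean H hH)
    -- Only the trace of the output second moment enters, since the test Gaussian has scalar
    -- covariance sI.
    have hJ : ∫ p, ∑ i, (A₀⁻¹ *ᵥ realVec (p.1 + H⁻¹ *ᵥ p.2)) i ^ 2 ∂(ν'.prod ζ) ≤ 2 * n := by
      simp_rw [hA₀d, sqrt_smul_one_inv_mulVec hs0, sum_realVec_sq]
      rw [integral_div, ← trace_secondMoment hvL, hvM, Matrix.trace_add, div_le_iff₀ hs0, hsn]
      linarith
    rw [hI, EReal.coe_le_coe_iff]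
    refine div_le_div_of_nonneg_right (hIle.trans ?_) hlb.le
    rw [hcap]
    linarith
  have hcapEq : capacity b H ζ S = ((cap / Real.log b : ℝ) : EReal) := by
    refine le_antisymm (iSup₂_le hupper) ?_
    -- The optimal input has real covariance sI − W, which makes the equivalent output covariance
    -- exactly sI. Its complementary covariance is −P, so it is improper unless P = 0.
    have hoptpos := posDef_smul_one_sub hWpos hWT hcs
    obtain ⟨νo, hGo, hmo, hMo⟩ := exists_gaussian hoptpos
    have hoadm : νo ∈ admissible n S := by
      refine mem_admissible_of_gaussian νo hmo (hMo ▸ hoptpos) ?_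
      rw [hMo, Matrix.trace_sub, Matrix.trace_smul, Matrix.trace_one]
      simp only [Fintype.card_sum, Fintype.card_fin, smul_eq_mul]
      push_cast
      linarith
    obtain ⟨I, hI, -, hIeq⟩ := mutualInfo_gaussian_bound H hH b ζ hmean hκ hdens hAz hζ νo
      hoadm.2.1 (memLp_realVec_gaussian νo) hA₀0
    replace hIeq := hIeq (equivalentOutput_eq_gaussOf H hH ζ νo hmean hmo A₀
      (by rw [hMo, hA₀, sub_add_cancel]))
    refine le_iSup₂_of_le νo hoadm ?_
    rw [hI, hIeq]
  -- the determinants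
  set M := (((n / totalPower H (covMat ζ) S : ℝ) : ℂ) •
    (H⁻¹ * compCovMat ζ * (H⁻¹)ᵀ)) with hM
  have hOC : complexCov (X + W) = ((2 * s : ℝ) : ℂ) • 1 := by
    rw [complexCov_add, hcov, sub_add_cancel]
  have hOP : complexCompCov (X + W) = complexCompCov W := by
    rw [complexCompCov_add, hcomp, zero_add]
  have hOT : (X + W)ᵀ = X + W := by rw [Matrix.transpose_add, hXT, hWT]
  have hfac : (n : ℝ) / (S + W.trace) = 1 / (2 * s) := by
    rw [← h2s, one_div_div]
  have hdet := det_eq_of_complexCov_eq_smul hOT hs0 hOC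
  rw [hOP, hWP, ← hfac, ← htp, ← hM, ← hμ] at hdet
  have hμsq : ∀ i, μ i ^ 2 < 1 / 4 := by
    intro i
    have h1 : ∀ u, normSqVec (complexCompCov W *ᵥ u) ≤ c ^ 2 * normSqVec u :=
      normSqVec_mulVec_le (complexCompCov_transpose hWT) hc0 fun u =>
        (norm_complexCompCov_form_le hWpos.posSemidef u).trans (re_form_le_opNorm _ u)
    have h2 : ∀ u, normSqVec (M *ᵥ u) ≤ (c / (2 * s)) ^ 2 * normSqVec u := by
      intro u
      rw [hM, htp, hfac, ← hWP, Matrix.smul_mulVec, normSqVec_smul, Complex.norm_real,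
        Real.norm_of_nonneg (by positivity)]
      calc (1 / (2 * s)) ^ 2 * normSqVec (complexCompCov W *ᵥ u)
          ≤ (1 / (2 * s)) ^ 2 * (c ^ 2 * normSqVec u) :=
            mul_le_mul_of_nonneg_left (h1 u) (by positivity)
        _ = _ := by ring
    rw [hμ]
    refine (singVal_sq_le h2 i).trans_lt ?_
    have h3 : c / (2 * s) < 1 / 2 := by
      rw [div_lt_iff₀ (by positivity)]; linarith
    have h4 : 0 ≤ c / (2 * s) := by positivity
    nlinarith
  have hpos : ∀ i, 0 < 1 - μ i ^ 2 := fun i => by linarith [hμsq i]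
  have hdetA' : A'.det * A'.det = s ^ (n + n) * ∏ i, (1 - μ i ^ 2) := by
    rw [← hdet, ← hA', Matrix.det_mul, Matrix.det_transpose]
  -- The factor ½ arises because these determinants belong to square-root factors of the output
  -- covariances.
  have hlog : Real.log |A₀.det| - Real.log |A'.det|
      = -(1 / 2) * ∑ i, Real.log (1 - μ i ^ 2) := by
    have e1 := congrArg Real.log hA₀det
    have e2 := congrArg Real.log hdetA'
    rw [Real.log_mul hA₀0 hA₀0] at e1
    rw [Real.log_mul hA'0 hA'0, Real.log_mul (pow_pos hs0 _).ne'
      (Finset.prod_pos fun i _ => hpos i).ne', Real.log_prod fun i _ => (hpos i).ne'] at e2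
    rw [Real.log_abs, Real.log_abs]
    linarith
  have hloss : cap / Real.log b - I' / Real.log b
      = -(1 / 2) * ∑ i, Real.logb b (1 - μ i ^ 2) := by
    simp only [Real.logb]
    rw [← Finset.sum_div, ← sub_div, ← mul_div_assoc, ← hlog, hcap, hI'eq]
    ring
  refine ⟨cap / Real.log b, I' / Real.log b, hcapEq, hI', hloss, ?_, ?_⟩
  · rw [hloss, Finset.mul_sum]
    exact Finset.sum_nonneg fun i _ => (log_one_sub_sq_bounds hb (hμsq i)).1
  · rw [hloss, Finset.mul_sum]
    have : Nonempty (Fin n) := ⟨⟨0, hn⟩⟩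
    calc ∑ i, -(1 / 2) * Real.logb b (1 - μ i ^ 2)
        < ∑ _i : Fin n, Real.logb b (2 / √3) :=
          Finset.sum_lt_sum_of_nonempty Finset.univ_nonempty fun i _ =>
            (log_one_sub_sq_bounds hb (hμsq i)).2
      _ = n * Real.logb b (2 / √3) := by simp
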